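/- Let $k\ge 2$ be an integer. For $i\ge 0$ put $\mathbf A_i=\begin{pmatrix} i+1&1\\1&0\end{pmatrix}$, and for $n\ge 0$ with base-$k$ expansion $(n)_k=i_s\cdots i_1i_0$ put $\kappa(n)=[1\ 0]\,\mathbf A_{i_0}\mathbf A_{i_1}\cdots \mathbf A_{i_s}\,[1\ 0]^T$. Let $K(z)=\sum_{n\ge 0}\kappa(n)z^n$ for $|z|<1$, and let $$\alpha_k=\frac{k(k+1)+k\sqrt{(k+1)^2+16}}{4}.$$ Then there are a function $C:(0,1)\to\mathbb R$ and a complex-valued function $\Omega$ on the set of all $\xi\in\mathbb C$ with $\xi^{k^m}=1$ for some integer $m\ge 0$, with the following properties. (a) $C$ is real-analytic, $|C|$ is bounded above and bounded below by a positive constant on $(0,1)$, $C(z)=C(z^k)$ for all $z\in(0,1)$, and for every integer $m\ge 0$, as $z\to1^-$, $$K(z^{k^m})=\frac{1}{\alpha_k^{m}}\cdot\frac{C(z)}{(1-z)^{\log_k\alpha_k}}\cdot(1+o(1)).$$ (b) $\Omega(1)=1$, and for every $\xi$ in the domain of $\Omega$, $$(\xi-1)\Omega(\xi)=\Bigl(k\,\xi^k-\sum_{a=0}^{k-1}\xi^a\Bigr)\alpha_k^{-1}\,\Omega(\xi^k)+\bigl(\xi^{k^2}-1\bigr)\alpha_k^{-2}\,\Omega(\xi^{k^2}).$$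 (c) For every integer $m\ge0$ and every $\xi\in\mathbb C$ with $\xi^{k^m}=1$, as $z\to1^-$, $$K(\xi z)=\Omega(\xi)\cdot\frac{C(z)}{(1-z)^{\log_k\alpha_k}}\cdot(1+o(1)).$$ -/

import Mathlib

open scoped Topology Matrix Asymptotics

noncomputable section

/-- The matrix `A_i = [[i + 1, 1], [1, 0]]`. -/
def digitMatrix (i : ℕ) : Matrix (Fin 2) (Fin 2) ℤ :=
  !![(i : ℤ) + 1, 1; 1, 0]

/-- `κ(n) = [1 0] A_{i₀} A_{i₁} ⋯ A_{i_s} [1 0]ᵀ`, where `i_s ⋯ i₁ i₀` is the base-`k` expansion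
of `n`. The list `Nat.digits k n` is `[i₀, i₁, …, i_s]`, least significant digit first. For `n = 0`
it is empty and the value is `1`, the same as for the one-digit word `0`. -/
def kappa (k n : ℕ) : ℤ :=
  ![1, 0] ⬝ᵥ (((Nat.digits k n).map digitMatrix).prod *ᵥ ![1, 0])

/-- The generating function `K(z) = ∑ κ(n) zⁿ`, used for `|z| < 1` only; the series converges there
because `κ` grows at most polynomially. -/
def genK (k : ℕ) (z : ℂ) : ℂ :=
  ∑' n : ℕ, (kappa k n : ℂ) * z ^ n

/-- `α_k = (k (k + 1) + k √((k + 1)² + 16)) / 4`. -/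
def alphaK (k : ℕ) : ℝ :=
  ((k : ℝ) * (k + 1) + k * √(((k : ℝ) + 1) ^ 2 + 16)) / 4

/-- The function `C` is the oscillatory term in the asymptotics of `K` at `1`: it is real-analytic
on `(0, 1)`, bounded away from `0` and `∞` there, satisfies `C(z) = C(z^k)`, and
`K(z^{k^m}) = α_k^{-m} · C(z) (1 - z)^{-log_k α_k} · (1 + o(1))` as `z → 1⁻` for every `m ≥ 0`.
The relation `f ~[l] g` says that `f = g · (1 + o(1))` along `l`. -/
structure IsOscillatoryTerm (k : ℕ) (C : ℝ → ℝ) : Prop where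
  analytic : AnalyticOnNhd ℝ C (Set.Ioo 0 1)
  bounded : ∃ c₁ c₂ : ℝ, 0 < c₁ ∧ ∀ z ∈ Set.Ioo (0 : ℝ) 1, c₁ ≤ |C z| ∧ |C z| ≤ c₂
  invariant : ∀ z ∈ Set.Ioo (0 : ℝ) 1, C z = C (z ^ k)
  asymptotics : ∀ m : ℕ,
    (fun z : ℝ => genK k ((z : ℂ) ^ (k ^ m))) ~[𝓝[<] 1]
      (fun z : ℝ =>
        ((1 / alphaK k ^ m * (C z / (1 - z) ^ Real.logb (k : ℝ) (alphaK k)) : ℝ) : ℂ))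

end

/-! Peeling off the lowest digit gives a Mahler-type equation `K(z) = W(z) K(z^k) + S(z) S(z^k)
K(z^{k²}) - S(z)` with `W = weightedGeom k`, `S = geom k` (`genK_functional`). Put `f_j(t) = α⁻ʲ
K(exp(-t/kʲ))`. As `j → ∞` the recursion for `f_j` has coefficients tending to `k(k+1)/(2α)` and
`k²/α²`. They sum to 1 by the quadratic equation of `α`, so consecutive differences contract by
about `k²/α² < 1`, up to `O(k⁻ʲ)`. Hence `f_j` converges locally uniformly on the right half-plane
to a holomorphic `F` with `F(kt) = α⁻¹F(t)`.

A lower bound from positive coefficients gives `F > 0` on the positive reals. Scaling to the compact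
interval `[1/k, 1]` turns uniform convergence into `K(e⁻ˢ) ~ F(s)` as `s → 0⁺`. The function `C(z)`
is `s^{log_k α} F(s)` at `s = -log z`: analyticity comes from `F`, and boundedness and invariance
from invariance under `s ↦ ks`.

At a root of unity `ξ` of `k`-power order, the functional equation expresses `K(ξe⁻ˢ)/F(s)` through
the same ratios at `ξ^k` and `ξ^{k²}`. Induction on the order gives limits `Ω(ξ)` and their
recursion. The form `~` in (c) also needs `Ω(ξ) ≠ 0`, which is
`boundaryLimit_ne_zero_and_re_nonneg`: the recursion becomes a continued fraction whose partial
terms stay in a half-plane. -/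

/-- The polynomial `∑_{a < k} (a + 1) z ^ a`. -/
def weightedGeom (k : ℕ) (z : ℂ) : ℂ := ∑ a ∈ Finset.range k, ((a : ℂ) + 1) * z ^ a

/-- The polynomial `∑_{a < k} z ^ a`. -/
def geom (k : ℕ) (z : ℂ) : ℂ := ∑ a ∈ Finset.range k, z ^ a

/-! ### Digit recursion and growth of `κ` -/

lemma kappa_zero (k : ℕ) : kappa k 0 = 1 := by
  simp [kappa]

/-- The second row `[1 0]` of a digit matrix skips the next digit, which produces `q / k`. For `q =
0` there is no next digit, and the correction cancels the spurious `κ(0) = 1`. -/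
lemma kappa_mul_add {k : ℕ} (hk : 2 ≤ k) (q : ℕ) {a : ℕ} (ha : a < k) :
    kappa k (k * q + a) = (a + 1) * kappa k q + kappa k (q / k) - if q = 0 then 1 else 0 := by
  have digits_step : ∀ q a, a < k → k * q + a ≠ 0 →
      Nat.digits k (k * q + a) = a :: Nat.digits k q := by
    intro q a ha h
    rw [add_comm, Nat.digits_add k (by omega) a q ha]
    by_contra! h'
    rcases h' with ⟨rfl, rfl⟩
    simp at h
  rcases Nat.eq_zero_or_pos q with rfl | hq
  · rcases Nat.eq_zero_or_pos a with rfl | ha0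
    · simp [kappa_zero]
    · unfold kappa
      rw [digits_step 0 a ha (by omega)]
      simp [digitMatrix, Matrix.mulVec, dotProduct, Matrix.mul_apply, Fin.sum_univ_two]
  · have hq' : q = k * (q / k) + q % k := (Nat.div_add_mod q k).symm
    have h1 := digits_step q a ha (by positivity)
    have h2 := digits_step (q / k) (q % k) (Nat.mod_lt _ (by omega)) (by omega)
    rw [← hq'] at h2
    unfold kappa
    rw [h1, h2, List.map_cons, List.map_cons, List.prod_cons, List.prod_cons]
    generalize ((Nat.digits k (q / k)).map digitMatrix).prod = M
    simp only [digitMatrix, Matrix.mulVec, dotProduct, Matrix.mul_apply, Fin.sum_univ_two]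
    simp [hq.ne']

lemma one_le_kappa {k : ℕ} (hk : 2 ≤ k) (n : ℕ) : 1 ≤ kappa k n := by
  induction n using Nat.strong_induction_on with
  | _ n ih =>
    rcases Nat.eq_zero_or_pos n with rfl | hn
    · simp [kappa_zero]
    · have h := kappa_mul_add hk (n / k) (Nat.mod_lt n (by omega : k > 0))
      rw [Nat.div_add_mod] at h
      have h1 := ih (n / k) (Nat.div_lt_self hn (by omega))
      have h2 := ih (n / k / k) ((Nat.div_le_self _ _).trans_lt (Nat.div_lt_self hn (by omega)))
      rw [h]
      have h3 : (0 : ℤ) ≤ ((n % k : ℕ) : ℤ) := by positivity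
      split_ifs <;> nlinarith

lemma kappa_le_sq {k : ℕ} (hk : 2 ≤ k) (n : ℕ) : kappa k n ≤ ((n : ℤ) + 1) ^ 2 := by
  induction n using Nat.strong_induction_on with
  | _ n ih =>
    rcases Nat.eq_zero_or_pos n with rfl | hn
    · simp [kappa_zero]
    · have ha : n % k < k := Nat.mod_lt n (by omega)
      have h := kappa_mul_add hk (n / k) ha
      have hn' := Nat.div_add_mod n k
      rw [hn'] at h
      have h1 := ih (n / k) (Nat.div_lt_self hn (by omega))
      have h2 := ih (n / k / k) ((Nat.div_le_self _ _).trans_lt (Nat.div_lt_self hn (by omega)))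
      have h3 : n / k / k ≤ n / k := Nat.div_le_self _ _
      have hqn : n / k = 0 ∨ 1 ≤ n / k := Nat.eq_zero_or_pos _
      generalize n % k = a at *
      generalize n / k / k = r at *
      generalize n / k = q at *
      rw [h]
      subst hn'
      have ha0 : (0 : ℤ) ≤ a := by positivity
      rcases hqn with rfl | hq
      · obtain rfl : r = 0 := by omega
        simp only [kappa_zero, if_true]
        push_cast
        nlinarith
      · rw [if_neg (Nat.one_le_iff_ne_zero.1 hq)]
        have h4 : ((r : ℤ) + 1) ^ 2 ≤ ((q : ℤ) + 1) ^ 2 := by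
          have : (r : ℤ) ≤ q := by exact_mod_cast h3
          gcongr
        have h5 : ((a : ℤ) + 1) * kappa k q ≤ (a + 1) * ((q : ℤ) + 1) ^ 2 := by gcongr
        have hq1 : (1 : ℤ) ≤ q := by exact_mod_cast hq
        have hak : (a : ℤ) + 1 ≤ k := by exact_mod_cast ha
        have hk2 : (2 : ℤ) ≤ k := by exact_mod_cast hk
        push_cast
        have h6 : ((a : ℤ) + 2) * ((q : ℤ) + 1) ^ 2 ≤ (k * q + a + 1) ^ 2 := by
          -- The digit 0 is separate because `a + 2 ≤ (a + 1)²` fails there; `k ≥ 2` and `q ≥ 1`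
          -- supply the slack instead.
          rcases Nat.eq_zero_or_pos a with rfl | ha1
          · have : (2 * (q : ℤ) + 1) ^ 2 ≤ (k * q + 0 + 1) ^ 2 := by
              gcongr ?_ ^ 2
              nlinarith
            push_cast
            nlinarith
          · have ha1' : (1 : ℤ) ≤ a := by exact_mod_cast ha1
            have : (((a : ℤ) + 1) * (q + 1)) ^ 2 ≤ (k * q + a + 1) ^ 2 := by
              gcongr ?_ ^ 2
              nlinarith
            have h7 : ((a : ℤ) + 2) * ((q : ℤ) + 1) ^ 2 ≤ (a + 1) ^ 2 * ((q : ℤ) + 1) ^ 2 := by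
              gcongr
              nlinarith
            nlinarith
        nlinarith

/-! ### Convergence in the disc and the functional equation -/

lemma summable_sq_mul_pow {r : ℝ} (h0 : 0 ≤ r) (h1 : r < 1) :
    Summable fun n : ℕ => ((n : ℝ) + 1) ^ 2 * r ^ n := by
  have hr : ‖r‖ < 1 := by rwa [Real.norm_of_nonneg h0]
  have h2 := summable_pow_mul_geometric_of_norm_lt_one 2 hr
  have h3 := summable_pow_mul_geometric_of_norm_lt_one 1 hr
  have h4 := summable_pow_mul_geometric_of_norm_lt_one 0 hr
  refine ((h2.add (h3.mul_left 2)).add h4).congr fun n => ?_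
  ring

lemma norm_kappa_le {k : ℕ} (hk : 2 ≤ k) (n : ℕ) : ‖(kappa k n : ℂ)‖ ≤ ((n : ℝ) + 1) ^ 2 := by
  rw [Complex.norm_intCast, abs_of_nonneg (by exact_mod_cast zero_le_one.trans (one_le_kappa hk n))]
  exact_mod_cast kappa_le_sq hk n

lemma norm_kappa_mul_pow_le {k : ℕ} (hk : 2 ≤ k) {z : ℂ} {r : ℝ} (hz : ‖z‖ ≤ r) (n : ℕ) :
    ‖(kappa k n : ℂ) * z ^ n‖ ≤ ((n : ℝ) + 1) ^ 2 * r ^ n := by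
  rw [norm_mul, norm_pow]
  have h1 := norm_kappa_le hk n
  gcongr

lemma summable_norm_kappa {k : ℕ} (hk : 2 ≤ k) {z : ℂ} (hz : ‖z‖ < 1) :
    Summable fun n : ℕ => (kappa k n : ℂ) * z ^ n :=
  Summable.of_norm_bounded (summable_sq_mul_pow (norm_nonneg z) hz)
    (norm_kappa_mul_pow_le hk le_rfl)

lemma norm_genK_le {k : ℕ} (hk : 2 ≤ k) {z : ℂ} {r : ℝ} (hz : ‖z‖ ≤ r) (hr : r < 1) :
    ‖genK k z‖ ≤ ∑' n : ℕ, ((n : ℝ) + 1) ^ 2 * r ^ n :=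
  tsum_of_norm_bounded (summable_sq_mul_pow ((norm_nonneg z).trans hz) hr).hasSum
    (norm_kappa_mul_pow_le hk hz)

lemma differentiableOn_genK {k : ℕ} (hk : 2 ≤ k) :
    DifferentiableOn ℂ (genK k) (Metric.ball 0 1) := by
  intro z hz
  obtain ⟨r, hzr, hr⟩ := exists_between (mem_ball_zero_iff.1 hz)
  have h := Complex.differentiableOn_tsum_of_summable_norm
    (F := fun (n : ℕ) (z : ℂ) => (kappa k n : ℂ) * z ^ n)
    (summable_sq_mul_pow ((norm_nonneg z).trans hzr.le) hr) (fun n => by fun_prop)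
    (Metric.isOpen_ball (α := ℂ) (x := 0) (ε := r))
    (fun n w hw => norm_kappa_mul_pow_le hk (mem_ball_zero_iff.1 hw).le n)
  exact (h.differentiableAt (Metric.isOpen_ball.mem_nhds (mem_ball_zero_iff.2 hzr)))
    |>.differentiableWithinAt

lemma hasSum_residue {k : ℕ} (hk : k ≠ 0) {f : ℕ → ℂ} (hf : Summable f) :
    HasSum (fun q => ∑ a ∈ Finset.range k, f (k * q + a)) (∑' n, f n) := by
  have : NeZero k := ⟨hk⟩
  have h := ((Nat.divModEquiv k).symm.hasSum_iff.2 hf.hasSum)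
  have h2 := h.prod_fiberwise (fun q => hasSum_fintype _)
  convert h2 using 2 with q
  rw [Finset.sum_range]
  refine Finset.sum_congr rfl fun a _ => ?_
  simp [Nat.divModEquiv, mul_comm]

lemma norm_pow_lt_one {z : ℂ} (hz : ‖z‖ < 1) {k : ℕ} (hk : k ≠ 0) : ‖z ^ k‖ < 1 := by
  rw [norm_pow]
  exact pow_lt_one₀ (norm_nonneg _) hz hk

lemma hasSum_kappa_div {k : ℕ} (hk : 2 ≤ k) {z : ℂ} (hz : ‖z‖ < 1) :
    HasSum (fun q : ℕ => (kappa k (q / k) : ℂ) * z ^ q) (geom k z * genK k (z ^ k)) := by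
  have hs : Summable fun q : ℕ => (kappa k (q / k) : ℂ) * z ^ q := by
    refine Summable.of_norm_bounded (summable_sq_mul_pow (norm_nonneg z) hz) fun n => ?_
    rw [norm_mul, norm_pow]
    have h1 : ‖(kappa k (n / k) : ℂ)‖ ≤ ((n : ℝ) + 1) ^ 2 := by
      refine (norm_kappa_le hk (n / k)).trans ?_
      gcongr
      exact Nat.div_le_self _ _
    gcongr
  have h := hasSum_residue (by omega : k ≠ 0) hs
  have h2 : HasSum (fun q => ∑ a ∈ Finset.range k, (kappa k ((k * q + a) / k) : ℂ) * z ^ (k * q + a))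
      (geom k z * genK k (z ^ k)) := by
    refine ((summable_norm_kappa hk (norm_pow_lt_one hz (by omega : k ≠ 0))).hasSum.mul_left
      (geom k z)).congr_fun ?_
    intro q
    rw [geom, Finset.sum_mul]
    refine Finset.sum_congr rfl fun a ha => ?_
    rw [Nat.mul_add_div (by omega), Nat.div_eq_of_lt (Finset.mem_range.1 ha), add_zero, pow_add,
      pow_mul]
    ring
  rw [h2.unique h]
  exact hs.hasSum

/-- This is `kappa_mul_add` summed over residue classes mod `k`; the `q / k` term is split by
residues a second time, which produces `z^{k²}`. -/
theorem genK_functional {k : ℕ} (hk : 2 ≤ k) {z : ℂ} (hz : ‖z‖ < 1) :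
    genK k z = weightedGeom k z * genK k (z ^ k)
      + geom k z * geom k (z ^ k) * genK k (z ^ (k ^ 2)) - geom k z := by
  have hzk := norm_pow_lt_one hz (by omega : k ≠ 0)
  have h := hasSum_residue (by omega : k ≠ 0) (summable_norm_kappa hk hz)
  have h1 := (summable_norm_kappa hk hzk).hasSum.mul_left (weightedGeom k z)
  have h2 := (hasSum_kappa_div hk hzk).mul_left (geom k z)
  have h3 : HasSum (fun q : ℕ => geom k z * if q = 0 then 1 else 0) (geom k z * 1) :=
    (hasSum_ite_eq 0 (1 : ℂ)).mul_left _
  have h4 := (h1.add h2).sub h3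
  have h5 := h.unique (h4.congr_fun ?_)
  · rw [← pow_mul, ← sq] at h5
    unfold genK at h5 ⊢
    rw [h5]
    ring
  · intro q
    simp only [weightedGeom, geom, Finset.sum_mul, ← Finset.sum_add_distrib,
      ← Finset.sum_sub_distrib]
    refine Finset.sum_congr rfl fun a ha => ?_
    rw [kappa_mul_add hk q (Finset.mem_range.1 ha), pow_add, pow_mul]
    push_cast
    split_ifs with hq
    · subst hq; simp; ring
    · simp; ring

/-! ### The growth rate `α` and the coefficients near `z = 1` -/

lemma alphaK_sq (k : ℕ) : alphaK k ^ 2 = (k * (k + 1) / 2 : ℝ) * alphaK k + (k : ℝ) ^ 2 := by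
  unfold alphaK
  have h : √(((k : ℝ) + 1) ^ 2 + 16) ^ 2 = ((k : ℝ) + 1) ^ 2 + 16 := Real.sq_sqrt (by positivity)
  linear_combination (k : ℝ) ^ 2 / 16 * h

/-- This makes the contraction ratio `k²/α²` smaller than 1. -/
lemma lt_alphaK {k : ℕ} (hk : 2 ≤ k) : (k : ℝ) < alphaK k := by
  unfold alphaK
  have h : (k : ℝ) + 1 ≤ √(((k : ℝ) + 1) ^ 2 + 16) := Real.le_sqrt_of_sq_le (by linarith)
  have hk' : (2 : ℝ) ≤ k := by exact_mod_cast hk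
  nlinarith

lemma alphaK_pos {k : ℕ} (hk : 2 ≤ k) : 0 < alphaK k :=
  (Nat.cast_nonneg k).trans_lt (lt_alphaK hk)

lemma weightedGeom_one (k : ℕ) : weightedGeom k 1 = (k * (k + 1) / 2 : ℝ) := by
  unfold weightedGeom
  induction k with
  | zero => simp
  | succ n ih =>
    rw [Finset.sum_range_succ, ih]
    push_cast
    ring

lemma geom_one (k : ℕ) : geom k 1 = k := by
  simp [geom]

lemma norm_geom_le (k : ℕ) {z : ℂ} (hz : ‖z‖ ≤ 1) : ‖geom k z‖ ≤ k := by
  refine (norm_sum_le _ _).trans ?_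
  refine (Finset.sum_le_card_nsmul _ _ 1 fun a _ => ?_).trans (by simp)
  rw [norm_pow]
  exact pow_le_one₀ (norm_nonneg _) hz

lemma norm_weightedGeom_le (k : ℕ) {z : ℂ} (hz : ‖z‖ ≤ 1) :
    ‖weightedGeom k z‖ ≤ k * (k + 1) / 2 := by
  have h : ‖weightedGeom k z‖ ≤ ∑ a ∈ Finset.range k, ((a : ℝ) + 1) := by
    refine (norm_sum_le _ _).trans (Finset.sum_le_sum fun a _ => ?_)
    rw [norm_mul, norm_pow]
    have : ‖(a : ℂ) + 1‖ = (a : ℝ) + 1 := by exact_mod_cast Complex.norm_natCast (a + 1)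
    rw [this]
    exact mul_le_of_le_one_right (by positivity) (pow_le_one₀ (norm_nonneg _) hz)
  refine h.trans (le_of_eq ?_)
  have := weightedGeom_one k
  simp only [weightedGeom, one_pow, mul_one] at this
  exact_mod_cast this

lemma norm_pow_sub_one_le (a : ℕ) {z : ℂ} (hz : ‖z‖ ≤ 1) : ‖z ^ a - 1‖ ≤ a * ‖z - 1‖ := by
  rw [← geom_sum_mul, norm_mul]
  gcongr
  exact norm_geom_le a hz

lemma norm_geom_sub_le (k : ℕ) {z : ℂ} (hz : ‖z‖ ≤ 1) : ‖geom k z - k‖ ≤ k ^ 2 * ‖z - 1‖ := by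
  rw [← geom_one, geom, geom, ← Finset.sum_sub_distrib]
  refine (norm_sum_le_of_le _ fun a ha => ?_).trans
    ((Finset.sum_le_card_nsmul (Finset.range k) _ (k * ‖z - 1‖) fun a _ => le_rfl).trans
      (by simp [sq, mul_assoc]))
  rw [one_pow]
  refine (norm_pow_sub_one_le a hz).trans ?_
  gcongr
  exact (Finset.mem_range.1 ha).le

lemma norm_weightedGeom_sub_le (k : ℕ) {z : ℂ} (hz : ‖z‖ ≤ 1) :
    ‖weightedGeom k z - (k * (k + 1) / 2 : ℝ)‖ ≤ k ^ 3 * ‖z - 1‖ := by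
  rw [← weightedGeom_one, weightedGeom, weightedGeom, ← Finset.sum_sub_distrib]
  refine (norm_sum_le_of_le _ fun a ha => ?_).trans
    ((Finset.sum_le_card_nsmul (Finset.range k) _ (k * (k * ‖z - 1‖)) fun a _ => le_rfl).trans
      (le_of_eq (by simp; ring)))
  rw [one_pow, ← mul_sub, norm_mul]
  have : ‖(a : ℂ) + 1‖ = (a : ℝ) + 1 := by exact_mod_cast Complex.norm_natCast (a + 1)
  have ha' : (a : ℝ) + 1 ≤ k := by exact_mod_cast Finset.mem_range.1 ha
  rw [this]
  refine mul_le_mul ha' ((norm_pow_sub_one_le a hz).trans ?_) (norm_nonneg _) (Nat.cast_nonneg _)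
  gcongr
  exact (Finset.mem_range.1 ha).le

lemma norm_exp_neg_sub_one_le {s : ℂ} (hs : 0 ≤ s.re) : ‖Complex.exp (-s) - 1‖ ≤ 2 * ‖s‖ := by
  rcases le_total ‖s‖ 1 with h | h
  · simpa using Complex.norm_exp_sub_one_le (x := -s) (by simpa using h)
  · have h1 : ‖Complex.exp (-s)‖ ≤ 1 := by simpa [Complex.norm_exp] using hs
    calc _ ≤ ‖Complex.exp (-s)‖ + ‖(1 : ℂ)‖ := norm_sub_le _ _
      _ ≤ 2 * ‖s‖ := by rw [norm_one]; linarith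

/-- A perturbed geometric recursion of ratio `< 1` has geometric decay. -/
lemma exists_geometric_bound {q r E : ℝ} (hq : 0 ≤ q) (hq1 : q < 1) (hr : 0 ≤ r) (hr1 : r < 1)
    (hE : 0 ≤ E) : ∃ θ D : ℝ, 0 ≤ θ ∧ θ < 1 ∧ ∀ d : ℕ → ℝ, d 0 ≤ E →
      (∀ j, d (j + 1) ≤ q * d j + E * r ^ j) → ∀ j, d j ≤ D * θ ^ j := by
  -- Taking `θ` strictly above both ratios avoids the extra factor `j` in the resonant case `q = r`.
  obtain ⟨θ, h1, h2⟩ := exists_between (max_lt hq1 hr1)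
  have hqθ : q < θ := (le_max_left _ _).trans_lt h1
  have hrθ : r < θ := (le_max_right _ _).trans_lt h1
  have hpos : 0 < θ - q := by linarith
  have hDE : E / (θ - q) * (θ - q) = E := div_mul_cancel₀ _ hpos.ne'
  have hD0 : 0 ≤ E / (θ - q) := by positivity
  refine ⟨θ, E / (θ - q), hq.trans hqθ.le, h2, fun d h0 hd j => ?_⟩
  generalize E / (θ - q) = D at *
  induction j with
  | zero => rw [pow_zero]; nlinarith
  | succ j ih =>
    have h3 : r ^ j ≤ θ ^ j := by gcongr
    have h4 : E * r ^ j ≤ E * θ ^ j := by gcongr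
    have h5 : q * d j ≤ q * (D * θ ^ j) := by gcongr
    calc d (j + 1) ≤ _ := hd j
      _ ≤ q * (D * θ ^ j) + E * θ ^ j := by linarith
      _ = D * θ ^ (j + 1) := by rw [← hDE]; ring

/-! ### Convergence of the rescaled functions -/

/-- The rescaled generating function `α⁻ʲ K(exp (-t / kʲ))`. -/
noncomputable def rescaled (k j : ℕ) (t : ℂ) : ℂ :=
  ((alphaK k : ℂ) ^ j)⁻¹ * genK k (Complex.exp (-(t / (k : ℂ) ^ j)))

lemma norm_exp_neg_lt_one {s : ℂ} (hs : 0 < s.re) : ‖Complex.exp (-s)‖ < 1 := by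
  simpa [Complex.norm_exp] using hs

lemma re_div_pow (k j : ℕ) (t : ℂ) : (t / (k : ℂ) ^ j).re = t.re / (k : ℝ) ^ j := by
  have : ((k : ℂ) ^ j) = (((k : ℝ) ^ j : ℝ) : ℂ) := by push_cast; rfl
  rw [this, Complex.div_ofReal_re]

lemma norm_exp_div_lt_one {k : ℕ} (hk : 2 ≤ k) (j : ℕ) {t : ℂ} (ht : 0 < t.re) :
    ‖Complex.exp (-(t / (k : ℂ) ^ j))‖ < 1 := by
  apply norm_exp_neg_lt_one
  rw [re_div_pow]
  have : (0 : ℝ) < k := by positivity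
  positivity

lemma exp_div_succ_pow {k : ℕ} (hk : 2 ≤ k) (j : ℕ) (t : ℂ) :
    Complex.exp (-(t / (k : ℂ) ^ (j + 1))) ^ k = Complex.exp (-(t / (k : ℂ) ^ j)) := by
  rw [← Complex.exp_nat_mul]
  have : (k : ℂ) ≠ 0 := by
    have : k ≠ 0 := by omega
    exact_mod_cast this
  congr 1
  field_simp
  ring

lemma exp_div_succ_succ_pow {k : ℕ} (hk : 2 ≤ k) (j : ℕ) (t : ℂ) :
    Complex.exp (-(t / (k : ℂ) ^ (j + 2))) ^ k ^ 2 = Complex.exp (-(t / (k : ℂ) ^ j)) := by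
  rw [sq, pow_mul, exp_div_succ_pow hk, exp_div_succ_pow hk]

lemma genK_exp_functional {k : ℕ} (hk : 2 ≤ k) (j : ℕ) {t : ℂ} (ht : 0 < t.re) :
    genK k (Complex.exp (-(t / (k : ℂ) ^ (j + 2)))) =
      weightedGeom k (Complex.exp (-(t / (k : ℂ) ^ (j + 2)))) *
          genK k (Complex.exp (-(t / (k : ℂ) ^ (j + 1))))
        + geom k (Complex.exp (-(t / (k : ℂ) ^ (j + 2)))) *
          geom k (Complex.exp (-(t / (k : ℂ) ^ (j + 1)))) *
          genK k (Complex.exp (-(t / (k : ℂ) ^ j)))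
        - geom k (Complex.exp (-(t / (k : ℂ) ^ (j + 2)))) := by
  rw [genK_functional hk (norm_exp_div_lt_one hk (j + 2) ht), exp_div_succ_pow hk (j + 1),
    exp_div_succ_succ_pow hk]

lemma alphaK_ne_zero {k : ℕ} (hk : 2 ≤ k) : (alphaK k : ℂ) ≠ 0 := by
  exact_mod_cast (alphaK_pos hk).ne'

lemma rescaled_recursion {k : ℕ} (hk : 2 ≤ k) (j : ℕ) {t : ℂ} (ht : 0 < t.re) :
    rescaled k (j + 2) t =
      weightedGeom k (Complex.exp (-(t / (k : ℂ) ^ (j + 2)))) * (alphaK k : ℂ)⁻¹ *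
          rescaled k (j + 1) t
        + geom k (Complex.exp (-(t / (k : ℂ) ^ (j + 2)))) *
          geom k (Complex.exp (-(t / (k : ℂ) ^ (j + 1)))) * ((alphaK k : ℂ) ^ 2)⁻¹ *
          rescaled k j t
        - geom k (Complex.exp (-(t / (k : ℂ) ^ (j + 2)))) * ((alphaK k : ℂ) ^ (j + 2))⁻¹ := by
  have h := alphaK_ne_zero hk
  rw [rescaled, genK_exp_functional hk j ht, rescaled, rescaled]
  field_simp
  ring

/-- Upper bounds for the two-step recursion satisfied by `K`. -/
lemma norm_rescaled_le {k : ℕ} (hk : 2 ≤ k) {t : ℂ} (ht : 0 < t.re) {M : ℝ}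
    (h0 : ‖genK k (Complex.exp (-t))‖ + 1 ≤ M)
    (h1 : ‖genK k (Complex.exp (-(t / k)))‖ + 1 ≤ M * alphaK k) (j : ℕ) :
    ‖rescaled k j t‖ ≤ M := by
  have hα := alphaK_pos hk
  have hk' : (2 : ℝ) ≤ k := by exact_mod_cast hk
  -- The added 1 absorbs the inhomogeneous term, of size at most `k`, so that the bound propagates
  -- through the quadratic equation of `α` with the same `M`.
  have key : ∀ j, ‖genK k (Complex.exp (-(t / (k : ℂ) ^ j)))‖ + 1 ≤ M * alphaK k ^ j := by
    intro j
    induction j using Nat.twoStepInduction with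
    | zero => simpa using h0
    | one => simpa using h1
    | more j ih0 ih1 =>
      rw [genK_exp_functional hk j ht]
      have b1 := norm_weightedGeom_le k (norm_exp_div_lt_one hk (j + 2) ht).le
      have b2 := norm_geom_le k (norm_exp_div_lt_one hk (j + 2) ht).le
      have b3 := norm_geom_le k (norm_exp_div_lt_one hk (j + 1) ht).le
      generalize genK k (Complex.exp (-(t / (k : ℂ) ^ j))) = x0 at *
      generalize genK k (Complex.exp (-(t / (k : ℂ) ^ (j + 1)))) = x1 at *
      generalize weightedGeom k (Complex.exp (-(t / (k : ℂ) ^ (j + 2)))) = w at *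
      generalize geom k (Complex.exp (-(t / (k : ℂ) ^ (j + 2)))) = s2 at *
      generalize geom k (Complex.exp (-(t / (k : ℂ) ^ (j + 1)))) = s1 at *
      have e1 : ‖w * x1 + s2 * s1 * x0 - s2‖ ≤ ‖w‖ * ‖x1‖ + ‖s2‖ * ‖s1‖ * ‖x0‖ + ‖s2‖ := by
        refine (norm_sub_le _ _).trans ?_
        gcongr
        refine (norm_add_le _ _).trans ?_
        simp
      have e2 : ‖w‖ * ‖x1‖ ≤ (k * (k + 1) / 2) * (M * alphaK k ^ (j + 1) - 1) := by
        gcongr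
        linarith
      have e3 : ‖s2‖ * ‖s1‖ * ‖x0‖ ≤ k * k * (M * alphaK k ^ j - 1) := by
        gcongr
        linarith
      have e4 : M * alphaK k ^ (j + 2) =
          (k * (k + 1) / 2) * (M * alphaK k ^ (j + 1)) + k * k * (M * alphaK k ^ j) := by
        linear_combination M * alphaK k ^ j * alphaK_sq k
      nlinarith
  rw [rescaled, norm_mul, norm_inv, norm_pow, Complex.norm_real, Real.norm_of_nonneg hα.le,
    inv_mul_le_iff₀ (by positivity)]
  linarith [key j]

/-- With the limiting coefficients `1 - c` and `c = k²/α²` the recursion reads `f_{j+2} - f_{j+1} =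
-c (f_{j+1} - f_j)`. The rest is the coefficients' deviation from their values at 1, `O(k⁻ʲ)`, plus
the inhomogeneous term, `O(α⁻ʲ)`. -/
lemma norm_rescaled_succ_sub_le {k : ℕ} (hk : 2 ≤ k) {t : ℂ} (ht : 0 < t.re) {M R : ℝ}
    (hR : ‖t‖ ≤ R) (hM : ∀ j, ‖rescaled k j t‖ ≤ M) (j : ℕ) :
    ‖rescaled k (j + 2) t - rescaled k (j + 1) t‖ ≤
      (k : ℝ) ^ 2 / alphaK k ^ 2 * ‖rescaled k (j + 1) t - rescaled k j t‖
        + (6 * k ^ 3 * R * M + k) * ((k : ℝ)⁻¹) ^ j := by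
  have hα := alphaK_pos hk
  have hα' := alphaK_ne_zero hk
  have hk' : (2 : ℝ) ≤ k := by exact_mod_cast hk
  have hα1 : 1 ≤ alphaK k := by linarith [lt_alphaK hk]
  have hsq : (alphaK k : ℂ) ^ 2 = (k * (k + 1) / 2 : ℝ) * alphaK k + (k : ℂ) ^ 2 := by
    exact_mod_cast alphaK_sq k
  have hR0 : 0 ≤ R := (norm_nonneg _).trans hR
  have hM0 : 0 ≤ M := (norm_nonneg _).trans (hM 0)
  have hx : ∀ i, j ≤ i → ‖Complex.exp (-(t / (k : ℂ) ^ i)) - 1‖ ≤ 2 * R * ((k : ℝ)⁻¹) ^ j := by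
    intro i hi
    refine (norm_exp_neg_sub_one_le ?_).trans ?_
    · rw [re_div_pow]; positivity
    · rw [norm_div, norm_pow, Complex.norm_natCast, inv_pow, div_eq_mul_inv, mul_assoc]
      have : ((k : ℝ) ^ i)⁻¹ ≤ ((k : ℝ) ^ j)⁻¹ := by
        gcongr
        linarith
      gcongr
  have z1 := (norm_exp_div_lt_one hk (j + 1) ht).le
  have z2 := (norm_exp_div_lt_one hk (j + 2) ht).le
  have hx1 := hx (j + 1) (by omega)
  have hx2 := hx (j + 2) (by omega)
  have hrec := rescaled_recursion hk j ht
  have b0 := hM j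
  have b1 := hM (j + 1)
  generalize rescaled k j t = f0 at *
  generalize rescaled k (j + 1) t = f1 at *
  generalize Complex.exp (-(t / (k : ℂ) ^ (j + 2))) = u2 at *
  generalize Complex.exp (-(t / (k : ℂ) ^ (j + 1))) = u1 at *
  have hid : rescaled k (j + 2) t - f1 =
      -(((k : ℂ) ^ 2 / (alphaK k : ℂ) ^ 2) * (f1 - f0))
        + (weightedGeom k u2 - (k * (k + 1) / 2 : ℝ)) * (alphaK k : ℂ)⁻¹ * f1
        + (geom k u2 * (geom k u1 - k) + k * (geom k u2 - k)) * ((alphaK k : ℂ) ^ 2)⁻¹ * f0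
        - geom k u2 * ((alphaK k : ℂ) ^ (j + 2))⁻¹ := by
    have h1 : ((k * (k + 1) / 2 : ℝ) : ℂ) * (alphaK k : ℂ)⁻¹ =
        1 - (k : ℂ) ^ 2 / (alphaK k : ℂ) ^ 2 := by
      field_simp
      linear_combination -hsq
    rw [hrec]
    linear_combination f1 * h1
  have i1 : ‖(alphaK k : ℂ)⁻¹‖ ≤ 1 := by
    rw [norm_inv, Complex.norm_real, Real.norm_of_nonneg hα.le]
    exact inv_le_one_of_one_le₀ hα1
  have i2 : ‖((alphaK k : ℂ) ^ 2)⁻¹‖ ≤ 1 := by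
    rw [← inv_pow, norm_pow]
    exact pow_le_one₀ (norm_nonneg _) i1
  have i3 : ‖((alphaK k : ℂ) ^ (j + 2))⁻¹‖ ≤ ((k : ℝ)⁻¹) ^ j := by
    rw [← inv_pow, norm_pow, pow_add]
    refine (mul_le_of_le_one_right (by positivity) (pow_le_one₀ (norm_nonneg _) i1)).trans ?_
    rw [norm_inv, Complex.norm_real, Real.norm_of_nonneg hα.le]
    gcongr
    exact (lt_alphaK hk).le
  have w2 := norm_weightedGeom_sub_le k z2
  have g2 := norm_geom_sub_le k z2
  have g1 := norm_geom_sub_le k z1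
  have s2 := norm_geom_le k z2
  have n1 : ‖((k : ℂ) ^ 2 / (alphaK k : ℂ) ^ 2) * (f1 - f0)‖ =
      (k : ℝ) ^ 2 / alphaK k ^ 2 * ‖f1 - f0‖ := by
    rw [norm_mul, norm_div, norm_pow, norm_pow, Complex.norm_real, Complex.norm_natCast,
      Real.norm_of_nonneg hα.le]
  set ρ := ((k : ℝ)⁻¹) ^ j with hρ
  have hρ0 : 0 ≤ ρ := by positivity
  have n2 : ‖(weightedGeom k u2 - (k * (k + 1) / 2 : ℝ)) * (alphaK k : ℂ)⁻¹ * f1‖ ≤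
      (k ^ 3 * (2 * R * ρ)) * 1 * M := by
    rw [norm_mul, norm_mul]
    gcongr
    exact w2.trans (by gcongr)
  have n3 : ‖(geom k u2 * (geom k u1 - k) + k * (geom k u2 - k)) * ((alphaK k : ℂ) ^ 2)⁻¹ * f0‖ ≤
      (k * (k ^ 2 * (2 * R * ρ)) + k * (k ^ 2 * (2 * R * ρ))) * 1 * M := by
    rw [norm_mul, norm_mul]
    gcongr
    refine (norm_add_le _ _).trans ?_
    rw [norm_mul, norm_mul, Complex.norm_natCast]
    gcongr
    · exact g1.trans (by gcongr)
    · exact g2.trans (by gcongr)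
  have n4 : ‖geom k u2 * ((alphaK k : ℂ) ^ (j + 2))⁻¹‖ ≤ k * ρ := by
    rw [norm_mul]
    gcongr
  rw [hid]
  refine (norm_sub_le _ _).trans ?_
  refine (add_le_add (norm_add₃_le) n4).trans ?_
  rw [norm_neg, n1]
  linarith

/-- The limit of the rescaled generating functions, written as a telescoping series. -/
noncomputable def rescaledLimit (k : ℕ) (t : ℂ) : ℂ :=
  rescaled k 0 t + ∑' j, (rescaled k (j + 1) t - rescaled k j t)

theorem tendstoUniformlyOn_rescaled {k : ℕ} (hk : 2 ≤ k) {δ : ℝ} (hδ : 0 < δ) (R : ℝ) :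
    TendstoUniformlyOn (rescaled k) (rescaledLimit k) Filter.atTop
      {t | δ ≤ t.re ∧ ‖t‖ ≤ R} := by
  have hα := alphaK_pos hk
  have hk' : (2 : ℝ) ≤ k := by exact_mod_cast hk
  have hα1 : 1 ≤ alphaK k := by linarith [lt_alphaK hk]
  rcases lt_or_ge R 0 with hR | hR
  · convert tendstoUniformlyOn_empty
    ext t
    simp only [Set.mem_ofPred_eq, Set.mem_empty_iff_false, iff_false]
    rintro ⟨_, h⟩
    linarith [norm_nonneg t]
  have hkpos : (0 : ℝ) < k := by linarith
  -- The radius `exp(-δ/k)` bounds both starting points `exp(-t)` and `exp(-t/k)` of the two-step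
  -- recursion.
  set M : ℝ := ∑' n : ℕ, ((n : ℝ) + 1) ^ 2 * Real.exp (-(δ / k)) ^ n + 1 with hMdef
  have hM0 : 0 ≤ M := by
    have : 0 ≤ ∑' n : ℕ, ((n : ℝ) + 1) ^ 2 * Real.exp (-(δ / k)) ^ n :=
      tsum_nonneg fun n => by positivity
    linarith
  have hr : Real.exp (-(δ / k)) < 1 := by
    rw [Real.exp_lt_one_iff]
    have : 0 < δ / k := by positivity
    linarith
  have hM : ∀ t : ℂ, δ ≤ t.re → ∀ j, ‖rescaled k j t‖ ≤ M := by
    intro t ht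
    have hdk : δ / k ≤ δ := div_le_self hδ.le (by linarith)
    refine norm_rescaled_le hk (hδ.trans_le ht) ?_ ?_
    · have := norm_genK_le hk (z := Complex.exp (-t)) (r := Real.exp (-(δ / k))) (by
        rw [Complex.norm_exp, Complex.neg_re]
        gcongr
        linarith) hr
      linarith
    · have := norm_genK_le hk (z := Complex.exp (-(t / k))) (r := Real.exp (-(δ / k))) (by
        rw [Complex.norm_exp, Complex.neg_re]
        have := re_div_pow k 1 t
        rw [pow_one, pow_one] at this
        rw [this]
        gcongr) hr
      nlinarith
  have hq1 : (k : ℝ) ^ 2 / alphaK k ^ 2 < 1 := by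
    rw [div_lt_one (by positivity)]
    have := lt_alphaK hk
    gcongr
  have hE : 0 ≤ 2 * M + (6 * k ^ 3 * R * M + k) := by positivity
  obtain ⟨θ, D, hθ0, hθ1, hD⟩ := exists_geometric_bound (q := (k : ℝ) ^ 2 / alphaK k ^ 2)
    (r := (k : ℝ)⁻¹) (by positivity) hq1 (by positivity) (inv_lt_one_of_one_lt₀ (by linarith)) hE
  have h := tendstoUniformlyOn_tsum_nat (u := fun j => D * θ ^ j)
    (f := fun j t => rescaled k (j + 1) t - rescaled k j t) (s := {t | δ ≤ t.re ∧ ‖t‖ ≤ R})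
    ((summable_geometric_of_lt_one hθ0 hθ1).mul_left D) (by
      rintro n t ⟨ht, htR⟩
      refine hD (fun j => ‖rescaled k (j + 1) t - rescaled k j t‖) ?_ (fun j => ?_) n
      · have h1 := norm_sub_le (rescaled k (0 + 1) t) (rescaled k 0 t)
        have h2 := hM t ht 0
        have h3 := hM t ht (0 + 1)
        have : 0 ≤ 6 * k ^ 3 * R * M + k := by positivity
        linarith
      · refine (norm_rescaled_succ_sub_le hk (hδ.trans_le ht) htR (hM t ht) j).trans ?_
        exact add_le_add le_rfl (mul_le_mul_of_nonneg_right (by linarith) (by positivity)))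
  rw [Metric.tendstoUniformlyOn_iff] at h ⊢
  intro ε hε
  filter_upwards [h ε hε] with n hn t ht
  have := hn t ht
  rw [Finset.sum_range_sub (fun j => rescaled k j t)] at this
  rw [dist_eq_norm] at this ⊢
  convert this using 2
  rw [rescaledLimit]
  ring

lemma tendsto_rescaled {k : ℕ} (hk : 2 ≤ k) {t : ℂ} (ht : 0 < t.re) :
    Filter.Tendsto (fun j => rescaled k j t) Filter.atTop (𝓝 (rescaledLimit k t)) :=
  (tendstoUniformlyOn_rescaled hk ht ‖t‖).tendsto_at ⟨le_rfl, le_rfl⟩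

lemma isOpen_rightHalfPlane : IsOpen {t : ℂ | 0 < t.re} :=
  isOpen_lt continuous_const Complex.continuous_re

theorem differentiableOn_rescaledLimit {k : ℕ} (hk : 2 ≤ k) :
    DifferentiableOn ℂ (rescaledLimit k) {t | 0 < t.re} := by
  have hloc : TendstoLocallyUniformlyOn (rescaled k) (rescaledLimit k) Filter.atTop
      {t : ℂ | 0 < t.re} := by
    refine tendstoLocallyUniformlyOn_of_forall_exists_nhds fun t ht => ?_
    have ht' : 0 < t.re := ht
    refine ⟨_, ?_, tendstoUniformlyOn_rescaled hk (half_pos ht') (‖t‖ + 1)⟩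
    refine mem_nhdsWithin_of_mem_nhds (Filter.inter_mem ?_ ?_)
    · exact Complex.continuous_re.continuousAt.eventually
        (Filter.Eventually.mono (lt_mem_nhds (half_lt_self ht')) fun _ h => le_of_lt h)
    · exact continuous_norm.continuousAt.eventually
        (Filter.Eventually.mono (gt_mem_nhds (lt_add_one ‖t‖)) fun _ h => le_of_lt h)
  refine hloc.differentiableOn (Filter.Eventually.of_forall fun j => ?_) isOpen_rightHalfPlane
  unfold rescaled
  refine DifferentiableOn.const_mul ?_ _
  refine (differentiableOn_genK hk).comp (by fun_prop) fun t ht => ?_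
  exact mem_ball_zero_iff.2 (norm_exp_div_lt_one hk j ht)

lemma rescaled_succ_mul {k : ℕ} (hk : 2 ≤ k) (j : ℕ) (t : ℂ) :
    rescaled k (j + 1) (k * t) = (alphaK k : ℂ)⁻¹ * rescaled k j t := by
  have hk0 : (k : ℂ) ≠ 0 := by
    have : k ≠ 0 := by omega
    exact_mod_cast this
  have : (k : ℂ) * t / (k : ℂ) ^ (j + 1) = t / (k : ℂ) ^ j := by
    field_simp
    ring
  rw [rescaled, rescaled, this, pow_succ, mul_inv]
  ring

lemma rescaledLimit_mul {k : ℕ} (hk : 2 ≤ k) {t : ℂ} (ht : 0 < t.re) :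
    rescaledLimit k (k * t) = (alphaK k : ℂ)⁻¹ * rescaledLimit k t := by
  have hkt : 0 < ((k : ℂ) * t).re := by
    have : (0 : ℝ) < k := by positivity
    simp only [Complex.mul_re, Complex.natCast_re, Complex.natCast_im, zero_mul, sub_zero]
    positivity
  have h1 := (tendsto_rescaled hk hkt).comp (Filter.tendsto_add_atTop_nat 1)
  have h2 := (tendsto_rescaled hk ht).const_mul ((alphaK k : ℂ)⁻¹)
  refine tendsto_nhds_unique h1 (h2.congr fun j => ?_)
  exact (rescaled_succ_mul hk j t).symm

/-! ### Positivity of the limit on the real axis -/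

/-- The generating function `K` on the real line. -/
noncomputable def realGenK (k : ℕ) (x : ℝ) : ℝ := ∑' n : ℕ, (kappa k n : ℝ) * x ^ n

lemma genK_ofReal (k : ℕ) (x : ℝ) : genK k (x : ℂ) = (realGenK k x : ℂ) := by
  simp [genK, realGenK, Complex.ofReal_tsum]

lemma realGenK_functional {k : ℕ} (hk : 2 ≤ k) {x : ℝ} (h0 : 0 ≤ x) (h1 : x < 1) :
    realGenK k x = (∑ a ∈ Finset.range k, ((a : ℝ) + 1) * x ^ a) * realGenK k (x ^ k)
      + (∑ a ∈ Finset.range k, x ^ a) * (∑ a ∈ Finset.range k, (x ^ k) ^ a) *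
        realGenK k (x ^ (k ^ 2)) - ∑ a ∈ Finset.range k, x ^ a := by
  have h := genK_functional hk (z := (x : ℂ)) (by
    rwa [Complex.norm_real, Real.norm_of_nonneg h0])
  rw [← Complex.ofReal_pow, ← Complex.ofReal_pow, genK_ofReal, genK_ofReal, genK_ofReal,
    weightedGeom, geom, geom] at h
  exact_mod_cast h

lemma one_lt_realGenK {k : ℕ} (hk : 2 ≤ k) {x : ℝ} (h0 : 0 < x) (h1 : x < 1) :
    1 < realGenK k x := by
  have hs : Summable fun n : ℕ => (kappa k n : ℝ) * x ^ n := by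
    have h := summable_norm_kappa hk (z := (x : ℂ)) (by
      rwa [Complex.norm_real, Real.norm_of_nonneg h0.le])
    exact_mod_cast h
  have hκ : ∀ n, (1 : ℝ) ≤ kappa k n := fun n => by exact_mod_cast one_le_kappa hk n
  have h := hs.sum_le_tsum (Finset.range 2) fun n _ =>
    mul_nonneg (zero_le_one.trans (hκ n)) (by positivity)
  rw [Finset.sum_range_succ, Finset.sum_range_one, pow_zero, pow_one] at h
  have h2 := hκ 0
  have h3 := hκ 1
  unfold realGenK
  nlinarith

lemma exp_neg_div_pow {k : ℕ} (hk : k ≠ 0) (j : ℕ) (t : ℝ) :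
    Real.exp (-(t / (k : ℝ) ^ (j + 1))) ^ k = Real.exp (-(t / (k : ℝ) ^ j)) := by
  rw [← Real.exp_nat_mul]
  congr 1
  field_simp
  ring

/-- Passing to `K - 1` removes the negative term: what remains is `W + S S' - S - 1`, nonnegative
because `W ≥ S` and `S, S' ≥ 1`. -/
lemma realGenK_sub_one_superrecursion {k : ℕ} (hk : 2 ≤ k) {x : ℝ} (h0 : 0 < x) (h1 : x < 1) :
    (k * (k + 1) / 2 * x ^ k) * (realGenK k (x ^ k) - 1)
      + (k * x ^ k) * (k * (x ^ k) ^ k) * (realGenK k (x ^ (k ^ 2)) - 1) ≤ realGenK k x - 1 := by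
  have hg : ∀ y : ℝ, 0 < y → y < 1 → k * y ^ k ≤ ∑ a ∈ Finset.range k, y ^ a := by
    intro y hy hy1
    have := Finset.card_nsmul_le_sum (Finset.range k) (fun a => y ^ a) (y ^ k) fun a ha =>
      pow_le_pow_of_le_one hy.le hy1.le (Finset.mem_range.1 ha).le
    simpa using this
  have hg1 : ∀ y : ℝ, 0 < y → 1 ≤ ∑ a ∈ Finset.range k, y ^ a := by
    intro y hy
    have := Finset.single_le_sum (f := fun a => y ^ a) (fun a _ => by positivity)
      (Finset.mem_range.2 (by omega : 0 < k))
    simpa using this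
  have hw : k * (k + 1) / 2 * x ^ k ≤ ∑ a ∈ Finset.range k, ((a : ℝ) + 1) * x ^ a := by
    have h : ∑ a ∈ Finset.range k, ((a : ℝ) + 1) = k * (k + 1) / 2 := by
      have := weightedGeom_one k
      simp only [weightedGeom, one_pow, mul_one] at this
      exact_mod_cast this
    rw [← h, Finset.sum_mul]
    refine Finset.sum_le_sum fun a ha => ?_
    gcongr ?_ * ?_
    exact pow_le_pow_of_le_one h0.le h1.le (Finset.mem_range.1 ha).le
  have hws : ∑ a ∈ Finset.range k, x ^ a ≤ ∑ a ∈ Finset.range k, ((a : ℝ) + 1) * x ^ a := by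
    refine Finset.sum_le_sum fun a _ => ?_
    have : 0 ≤ (a : ℝ) * x ^ a := by positivity
    linarith
  have hxk : 0 < x ^ k := by positivity
  have hxk1 : x ^ k < 1 := pow_lt_one₀ h0.le h1 (by omega)
  have hK1 := one_lt_realGenK hk hxk hxk1
  have hK0 := one_lt_realGenK hk (x := x ^ k ^ 2) (by positivity)
    (pow_lt_one₀ h0.le h1 (by positivity))
  rw [realGenK_functional hk h0.le h1]
  have a1 := hg x h0 h1
  have a2 := hg _ hxk hxk1
  have a3 := hg1 x h0
  have a4 := hg1 _ hxk
  generalize realGenK k (x ^ k) = K1 at *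
  generalize realGenK k (x ^ k ^ 2) = K0 at *
  generalize ∑ a ∈ Finset.range k, x ^ a = S at *
  generalize ∑ a ∈ Finset.range k, (x ^ k) ^ a = S' at *
  generalize ∑ a ∈ Finset.range k, ((a : ℝ) + 1) * x ^ a = W at *
  have c1 : (k * (k + 1) / 2 * x ^ k) * (K1 - 1) ≤ W * (K1 - 1) := by
    gcongr
  have c2 : (k * x ^ k) * (k * (x ^ k) ^ k) * (K0 - 1) ≤ S * S' * (K0 - 1) := by
    gcongr
  nlinarith

lemma rescaled_ofReal (k j : ℕ) (t : ℝ) :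
    rescaled k j (t : ℂ) =
      (((alphaK k ^ j)⁻¹ * realGenK k (Real.exp (-(t / (k : ℝ) ^ j))) : ℝ) : ℂ) := by
  rw [rescaled, Complex.ofReal_mul, ← genK_ofReal]
  push_cast
  rfl

lemma exists_lower_bound_realGenK {k : ℕ} (hk : 2 ≤ k) {t : ℝ} (ht : 0 < t) :
    ∃ δ : ℝ, 0 < δ ∧ ∀ j, δ ≤ (alphaK k ^ j)⁻¹ * realGenK k (Real.exp (-(t / (k : ℝ) ^ j))) := by
  have hα := alphaK_pos hk
  have hk' : (2 : ℝ) ≤ k := by exact_mod_cast hk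
  have hk0 : k ≠ 0 := by omega
  have hkpos : (0 : ℝ) < k := by linarith
  have hx1 : ∀ j, Real.exp (-(t / (k : ℝ) ^ j)) < 1 := fun j => by
    rw [Real.exp_lt_one_iff]
    have : 0 < t / (k : ℝ) ^ j := by positivity
    linarith
  have hpos : ∀ j, 0 < realGenK k (Real.exp (-(t / (k : ℝ) ^ j))) - 1 := fun j => by
    linarith [one_lt_realGenK hk (Real.exp_pos _) (hx1 j)]
  have hmin : ∃ δ : ℝ, 0 < δ ∧
      δ * Real.exp (2 * (t / (k : ℝ) ^ 0)) ≤ realGenK k (Real.exp (-(t / (k : ℝ) ^ 0))) - 1 ∧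
      δ * Real.exp (2 * (t / (k : ℝ) ^ 1)) ≤
        (alphaK k)⁻¹ * (realGenK k (Real.exp (-(t / (k : ℝ) ^ 1))) - 1) := by
    refine ⟨min ((realGenK k (Real.exp (-(t / (k : ℝ) ^ 0))) - 1) /
        Real.exp (2 * (t / (k : ℝ) ^ 0)))
      (((alphaK k)⁻¹ * (realGenK k (Real.exp (-(t / (k : ℝ) ^ 1))) - 1)) /
        Real.exp (2 * (t / (k : ℝ) ^ 1))), ?_, ?_, ?_⟩
    · have := hpos 0
      have := hpos 1
      exact lt_min (by positivity) (by positivity)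
    · rw [← le_div_iff₀ (Real.exp_pos _)]
      exact min_le_left _ _
    · rw [← le_div_iff₀ (Real.exp_pos _)]
      exact min_le_right _ _
  obtain ⟨δ, hδ, hδ0, hδ1⟩ := hmin
  -- The weight `exp(2s)` pays for the losses `exp(-ks)` and `exp(-ks - k²s)` in the superrecursion:
  -- it suffices that `2 ≤ k` and `2 ≤ k² - k`.
  have key : ∀ j, δ * alphaK k ^ j * Real.exp (2 * (t / (k : ℝ) ^ j)) ≤
      realGenK k (Real.exp (-(t / (k : ℝ) ^ j))) - 1 := by
    intro j
    induction j using Nat.twoStepInduction with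
    | zero => simpa using hδ0
    | one =>
      rw [inv_mul_eq_div, le_div_iff₀ hα] at hδ1
      simp only [pow_one] at hδ1 ⊢
      linarith
    | more j ih0 ih1 =>
      have h := realGenK_sub_one_superrecursion hk (Real.exp_pos _) (hx1 (j + 2))
      rw [sq k, pow_mul, exp_neg_div_pow hk0 (j + 1), exp_neg_div_pow hk0 j] at h
      have hs1 : t / (k : ℝ) ^ (j + 1) = k * (t / (k : ℝ) ^ (j + 2)) := by
        field_simp
        ring
      have hs0 : t / (k : ℝ) ^ j = k ^ 2 * (t / (k : ℝ) ^ (j + 2)) := by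
        field_simp
        ring
      have hspos : 0 < t / (k : ℝ) ^ (j + 2) := by positivity
      rw [hs1, hs0] at h
      rw [hs1] at ih1
      rw [hs0] at ih0
      refine le_trans ?_ h
      clear hs0 hs1
      generalize t / (k : ℝ) ^ (j + 2) = s at *
      have e1 : Real.exp (2 * s) ≤ Real.exp (-(k * s)) * Real.exp (2 * (k * s)) := by
        rw [← Real.exp_add]
        gcongr
        nlinarith
      have e2 : Real.exp (2 * s) ≤
          Real.exp (-(k * s)) * Real.exp (-(k ^ 2 * s)) * Real.exp (2 * (k ^ 2 * s)) := by
        rw [← Real.exp_add, ← Real.exp_add]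
        gcongr
        nlinarith [mul_nonneg hspos.le (by nlinarith : (0 : ℝ) ≤ k ^ 2 - k - 2)]
      calc δ * alphaK k ^ (j + 2) * Real.exp (2 * s)
          = (k * (k + 1) / 2) * (δ * alphaK k ^ (j + 1)) * Real.exp (2 * s) +
            k * k * (δ * alphaK k ^ j) * Real.exp (2 * s) := by
            linear_combination δ * alphaK k ^ j * Real.exp (2 * s) * alphaK_sq k
        _ ≤ (k * (k + 1) / 2) * (δ * alphaK k ^ (j + 1)) *
              (Real.exp (-(k * s)) * Real.exp (2 * (k * s))) +
            k * k * (δ * alphaK k ^ j) * (Real.exp (-(k * s)) * Real.exp (-(k ^ 2 * s)) *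
              Real.exp (2 * (k ^ 2 * s))) := by gcongr
        _ = (k * (k + 1) / 2) * Real.exp (-(k * s)) *
              (δ * alphaK k ^ (j + 1) * Real.exp (2 * (k * s))) +
            (k * Real.exp (-(k * s))) * (k * Real.exp (-(k ^ 2 * s))) *
              (δ * alphaK k ^ j * Real.exp (2 * (k ^ 2 * s))) := by ring
        _ ≤ _ := by gcongr
  refine ⟨δ, hδ, fun j => ?_⟩
  rw [inv_mul_eq_div, le_div_iff₀ (by positivity)]
  have h1 : 1 ≤ Real.exp (2 * (t / (k : ℝ) ^ j)) := Real.one_le_exp (by positivity)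
  have h2 : δ * alphaK k ^ j * 1 ≤ δ * alphaK k ^ j * Real.exp (2 * (t / (k : ℝ) ^ j)) := by
    gcongr
  linarith [key j]

/-- The restriction of the scaling limit to the positive reals. -/
noncomputable def scalingLimit (k : ℕ) (t : ℝ) : ℝ := (rescaledLimit k (t : ℂ)).re

lemma tendsto_realGenK_rescaled {k : ℕ} (hk : 2 ≤ k) {t : ℝ} (ht : 0 < t) :
    Filter.Tendsto
      (fun j => (alphaK k ^ j)⁻¹ * realGenK k (Real.exp (-(t / (k : ℝ) ^ j))))
      Filter.atTop (𝓝 (scalingLimit k t)) := by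
  have h := (Complex.continuous_re.tendsto _).comp
    (tendsto_rescaled hk (t := (t : ℂ)) (by simpa using ht))
  refine h.congr fun j => ?_
  rw [Function.comp_apply, rescaled_ofReal, Complex.ofReal_re]

lemma scalingLimit_pos {k : ℕ} (hk : 2 ≤ k) {t : ℝ} (ht : 0 < t) : 0 < scalingLimit k t := by
  obtain ⟨δ, hδ, h⟩ := exists_lower_bound_realGenK hk ht
  exact hδ.trans_le (ge_of_tendsto' (tendsto_realGenK_rescaled hk ht) h)

lemma scalingLimit_mul {k : ℕ} (hk : 2 ≤ k) {t : ℝ} (ht : 0 < t) :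
    scalingLimit k (k * t) = (alphaK k)⁻¹ * scalingLimit k t := by
  unfold scalingLimit
  rw [Complex.ofReal_mul, Complex.ofReal_natCast, rescaledLimit_mul hk (by simpa using ht),
    ← Complex.ofReal_inv, Complex.re_ofReal_mul]

lemma scalingLimit_pow_mul {k : ℕ} (hk : 2 ≤ k) (n : ℕ) {t : ℝ} (ht : 0 < t) :
    scalingLimit k ((k : ℝ) ^ n * t) = (alphaK k ^ n)⁻¹ * scalingLimit k t := by
  induction n with
  | zero => simp
  | succ n ih =>
    have : (0 : ℝ) < k := by positivity
    rw [pow_succ', mul_assoc, scalingLimit_mul hk (by positivity), ih, pow_succ', mul_inv, mul_assoc]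

lemma analyticAt_scalingLimit {k : ℕ} (hk : 2 ≤ k) {t : ℝ} (ht : 0 < t) :
    AnalyticAt ℝ (scalingLimit k) t :=
  ((differentiableOn_rescaledLimit hk).analyticAt
    (isOpen_rightHalfPlane.mem_nhds (by simpa using ht))).re_ofReal

lemma continuousOn_scalingLimit {k : ℕ} (hk : 2 ≤ k) : ContinuousOn (scalingLimit k) (Set.Ioi 0) :=
  fun _ ht => (analyticAt_scalingLimit hk ht).continuousAt.continuousWithinAt

/-! ### Asymptotics at 1 and the oscillating factor -/

/-- Every positive real is a `k`-power multiple of a real in `[1/k, 1]`. -/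
lemma exists_pow_mul_mem_Icc {k : ℕ} (hk : 2 ≤ k) {s : ℝ} (hs : 0 < s) (hs1 : s ≤ 1) :
    ∃ n : ℕ, (k : ℝ) ^ n * s ∈ Set.Icc (k : ℝ)⁻¹ 1 := by
  have hk' : (2 : ℝ) ≤ k := by exact_mod_cast hk
  obtain ⟨n, h1, h2⟩ := exists_nat_pow_near ((one_le_inv₀ hs).2 hs1) (by linarith : (1 : ℝ) < k)
  refine ⟨n, ?_, ?_⟩
  · rw [inv_le_iff_one_le_mul₀ (by linarith)]
    rw [inv_lt_iff_one_lt_mul₀ hs, pow_succ] at h2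
    linarith
  · rwa [le_inv_comm₀ (by positivity) hs, ← one_div, le_div_iff₀ (by positivity), mul_comm] at h1

/-- Write `s = t/kⁿ` with `t ∈ [1/k, 1]`. The ratio at `s` is `f_n(t)/F(t)`, and on this compact
interval uniform convergence together with the positive minimum of `F` controls the relative error.
-/
theorem tendsto_realGenK_div_scalingLimit {k : ℕ} (hk : 2 ≤ k) :
    Filter.Tendsto (fun s : ℝ => realGenK k (Real.exp (-s)) / scalingLimit k s) (𝓝[>] 0) (𝓝 1) := by
  have hα := alphaK_pos hk
  have hk' : (2 : ℝ) ≤ k := by exact_mod_cast hk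
  have hkpos : (0 : ℝ) < k := by linarith
  have hsub : Set.Icc (k : ℝ)⁻¹ 1 ⊆ Set.Ioi 0 := fun t ht => (inv_pos.2 hkpos).trans_le ht.1
  obtain ⟨t0, ht0, hmin⟩ := (isCompact_Icc (a := (k : ℝ)⁻¹) (b := 1)).exists_isMinOn
    ⟨1, inv_le_one_of_one_le₀ (by linarith), le_rfl⟩ ((continuousOn_scalingLimit hk).mono hsub)
  have hm := scalingLimit_pos hk (hsub ht0)
  set m := scalingLimit k t0
  have hunif := Metric.tendstoUniformlyOn_iff.1
    (tendstoUniformlyOn_rescaled hk (inv_pos.2 hkpos) 1)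
  rw [Metric.tendsto_nhds]
  intro ε hε
  obtain ⟨J, hJ⟩ := Filter.eventually_atTop.1 (hunif (ε * m) (by positivity))
  have hJpos : 0 < ((k : ℝ) ^ J)⁻¹ := by positivity
  filter_upwards [Ioo_mem_nhdsGT hJpos] with s hs
  have hspos := hs.1
  have hs1 : s ≤ 1 := hs.2.le.trans (inv_le_one_of_one_le₀ (one_le_pow₀ (by linarith)))
  obtain ⟨n, hn⟩ := exists_pow_mul_mem_Icc hk hspos hs1
  have hnJ : J ≤ n := by
    have h1 : ((k : ℝ) ^ (n + 1))⁻¹ ≤ s := by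
      rw [inv_le_iff_one_le_mul₀ (by positivity)]
      have := hn.1
      rw [inv_le_iff_one_le_mul₀ hkpos] at this
      rw [pow_succ]
      linarith
    have h2 := (inv_lt_inv₀ (by positivity) (by positivity)).1 (h1.trans_lt hs.2)
    have h3 := (pow_lt_pow_iff_right₀ (by linarith : (1 : ℝ) < k)).1 h2
    omega
  set t := (k : ℝ) ^ n * s with ht
  have htpos : 0 < t := hsub hn
  have hst : t / (k : ℝ) ^ n = s := by
    rw [ht]
    field_simp
  have hFt := scalingLimit_pos hk htpos
  have hmt : m ≤ scalingLimit k t := hmin hn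
  have hdist := hJ n hnJ (t : ℂ) ⟨by simpa using hn.1, by
    rw [Complex.norm_real, Real.norm_of_nonneg htpos.le]; exact hn.2⟩
  have hre : |scalingLimit k t - (alphaK k ^ n)⁻¹ * realGenK k (Real.exp (-s))| < ε * m := by
    rw [dist_eq_norm] at hdist
    refine lt_of_le_of_lt ?_ hdist
    refine le_trans (le_of_eq ?_) (Complex.abs_re_le_norm _)
    rw [Complex.sub_re, rescaled_ofReal, Complex.ofReal_re, hst, scalingLimit]
  have hFs : scalingLimit k s = alphaK k ^ n * scalingLimit k t := by
    rw [ht, scalingLimit_pow_mul hk n hspos]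
    field_simp
  have hid : realGenK k (Real.exp (-s)) / scalingLimit k s - 1 =
      -(scalingLimit k t - (alphaK k ^ n)⁻¹ * realGenK k (Real.exp (-s))) / scalingLimit k t := by
    rw [hFs]
    field_simp
    ring
  rw [Real.dist_eq, hid, abs_div, abs_neg, abs_of_pos hFt, div_lt_iff₀ hFt]
  refine hre.trans_le ?_
  gcongr

lemma one_lt_alphaK {k : ℕ} (hk : 2 ≤ k) : 1 < alphaK k := by
  have hk' : (2 : ℝ) ≤ k := by exact_mod_cast hk
  linarith [lt_alphaK hk]

lemma logb_alphaK_pos {k : ℕ} (hk : 2 ≤ k) : 0 < Real.logb k (alphaK k) :=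
  Real.logb_pos (by exact_mod_cast hk) (one_lt_alphaK hk)

/-- The scaling limit normalised by the power `t ^ log_k α`. -/
noncomputable def scalingOsc (k : ℕ) (t : ℝ) : ℝ :=
  t ^ Real.logb k (alphaK k) * scalingLimit k t

lemma scalingOsc_pos {k : ℕ} (hk : 2 ≤ k) {t : ℝ} (ht : 0 < t) : 0 < scalingOsc k t :=
  mul_pos (Real.rpow_pos_of_pos ht _) (scalingLimit_pos hk ht)

lemma scalingOsc_mul {k : ℕ} (hk : 2 ≤ k) {t : ℝ} (ht : 0 < t) :
    scalingOsc k (k * t) = scalingOsc k t := by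
  have hk' : (2 : ℝ) ≤ k := by exact_mod_cast hk
  have hα := alphaK_pos hk
  rw [scalingOsc, scalingOsc, scalingLimit_mul hk ht, Real.mul_rpow (by linarith) ht.le,
    Real.rpow_logb (by linarith) (by linarith) hα]
  field_simp

lemma scalingOsc_pow_mul {k : ℕ} (hk : 2 ≤ k) (n : ℕ) {t : ℝ} (ht : 0 < t) :
    scalingOsc k ((k : ℝ) ^ n * t) = scalingOsc k t := by
  induction n with
  | zero => simp
  | succ n ih =>
    have : (0 : ℝ) < k := by positivity
    rw [pow_succ', mul_assoc, scalingOsc_mul hk (by positivity), ih]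

lemma continuousOn_scalingOsc {k : ℕ} (hk : 2 ≤ k) : ContinuousOn (scalingOsc k) (Set.Ioi 0) :=
  (continuousOn_id.rpow_const fun _ ht => Or.inl (ne_of_gt ht)).mul (continuousOn_scalingLimit hk)

lemma exists_scalingOsc_bounds {k : ℕ} (hk : 2 ≤ k) :
    ∃ c₁ c₂ : ℝ, 0 < c₁ ∧ ∀ t : ℝ, 0 < t → c₁ ≤ scalingOsc k t ∧ scalingOsc k t ≤ c₂ := by
  have hk' : (2 : ℝ) ≤ k := by exact_mod_cast hk
  have hkpos : (0 : ℝ) < k := by linarith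
  have hsub : Set.Icc (k : ℝ)⁻¹ 1 ⊆ Set.Ioi 0 := fun t ht => (inv_pos.2 hkpos).trans_le ht.1
  have hne : (Set.Icc (k : ℝ)⁻¹ 1).Nonempty := ⟨1, inv_le_one_of_one_le₀ (by linarith), le_rfl⟩
  have hcont := (continuousOn_scalingOsc hk).mono hsub
  obtain ⟨a, ha, hmin⟩ := isCompact_Icc.exists_isMinOn hne hcont
  obtain ⟨b, hb, hmax⟩ := isCompact_Icc.exists_isMaxOn hne hcont
  refine ⟨scalingOsc k a, scalingOsc k b, scalingOsc_pos hk (hsub ha), fun t ht => ?_⟩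
  obtain ⟨n, hn⟩ := pow_unbounded_of_one_lt t (by linarith : (1 : ℝ) < k)
  have hs : 0 < t / (k : ℝ) ^ n := by positivity
  obtain ⟨i, hi⟩ := exists_pow_mul_mem_Icc hk hs ((div_le_one (by positivity)).2 hn.le)
  have h1 : scalingOsc k t = scalingOsc k ((k : ℝ) ^ i * (t / (k : ℝ) ^ n)) := by
    rw [scalingOsc_pow_mul hk i hs, ← scalingOsc_pow_mul hk n hs,
      mul_div_cancel₀ _ (by positivity)]
  rw [h1]
  exact ⟨hmin hi, hmax hi⟩

/-- This eliminates the inhomogeneous term of the functional equation after division by `F`. -/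
lemma tendsto_inv_scalingLimit {k : ℕ} (hk : 2 ≤ k) :
    Filter.Tendsto (fun s => (scalingLimit k s)⁻¹) (𝓝[>] 0) (𝓝 0) := by
  obtain ⟨c₁, c₂, hc, hb⟩ := exists_scalingOsc_bounds hk
  have hβ := logb_alphaK_pos hk
  have h : Filter.Tendsto (fun s : ℝ => s ^ Real.logb k (alphaK k) * c₁⁻¹) (𝓝[>] 0) (𝓝 0) := by
    have := ((Real.continuousAt_rpow_const 0 _ (Or.inr hβ.le)).tendsto.mono_left
      (nhdsWithin_le_nhds (s := Set.Ioi 0))).mul_const c₁⁻¹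
    rwa [Real.zero_rpow hβ.ne', zero_mul] at this
  refine squeeze_zero' ?_ ?_ h
  · filter_upwards [self_mem_nhdsWithin] with s hs
    exact inv_nonneg.2 (scalingLimit_pos hk hs).le
  · filter_upwards [self_mem_nhdsWithin] with s hs
    have hs' : (0 : ℝ) < s := hs
    have h1 := (hb s hs).1
    have h2 := scalingLimit_pos hk hs
    rw [← div_eq_mul_inv, inv_le_comm₀ h2 (by positivity), inv_div,
      div_le_iff₀ (Real.rpow_pos_of_pos hs _), mul_comm]
    exact h1

lemma tendsto_neg_log : Filter.Tendsto (fun z : ℝ => -Real.log z) (𝓝[<] 1) (𝓝[>] 0) := by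
  refine tendsto_nhdsWithin_iff.2 ⟨?_, ?_⟩
  · have := (Real.continuousAt_log one_ne_zero).neg.tendsto.mono_left
      (nhdsWithin_le_nhds (s := Set.Iio 1))
    rwa [Pi.neg_apply, Real.log_one, neg_zero] at this
  · filter_upwards [Ioo_mem_nhdsLT zero_lt_one] with z hz
    exact neg_pos.2 (Real.log_neg hz.1 hz.2)

lemma tendsto_one_sub_div_neg_log :
    Filter.Tendsto (fun z : ℝ => (1 - z) / -Real.log z) (𝓝[<] 1) (𝓝 1) := by
  have h := (hasDerivAt_iff_tendsto_slope.1 (Real.hasDerivAt_log one_ne_zero)).mono_left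
    (nhdsWithin_mono 1 (fun z (hz : z < 1) => ne_of_lt hz))
  have h2 := h.inv₀ (by norm_num)
  rw [inv_one, inv_one] at h2
  refine h2.congr fun z => ?_
  rw [slope_def_field, Real.log_one, sub_zero, inv_div, div_neg, ← neg_div, neg_sub]

/-- Asymptotics relative to the scaling limit, rewritten in the variable `z = exp (-s)`. -/
lemma isEquivalent_of_tendsto_div_scalingLimit {k : ℕ} (hk : 2 ≤ k) {g : ℝ → ℂ} {L : ℂ}
    (hL : L ≠ 0)
    (h : Filter.Tendsto (fun s => g s / (scalingLimit k s : ℂ)) (𝓝[>] 0) (𝓝 L)) :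
    (fun z : ℝ => g (-Real.log z)) ~[𝓝[<] 1] fun z : ℝ => L *
      ((scalingOsc k (-Real.log z) / (1 - z) ^ Real.logb (k : ℝ) (alphaK k) : ℝ) : ℂ) := by
  have h1 := (h.comp tendsto_neg_log).div_const L
  have h2 : Filter.Tendsto
      (fun z : ℝ => ((((1 - z) / -Real.log z) ^ Real.logb k (alphaK k) : ℝ) : ℂ)) (𝓝[<] 1)
      (𝓝 1) := by
    have := (Real.continuousAt_rpow_const 1 (Real.logb k (alphaK k))
      (Or.inl one_ne_zero)).tendsto.comp tendsto_one_sub_div_neg_log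
    rw [Real.one_rpow] at this
    have := (Complex.continuous_ofReal.tendsto 1).comp this
    rwa [Complex.ofReal_one] at this
  have h3 := h1.mul h2
  rw [div_self hL, one_mul] at h3
  refine Asymptotics.isEquivalent_of_tendsto_one (h3.congr' ?_)
  filter_upwards [Ioo_mem_nhdsLT zero_lt_one] with z hz
  have hs : 0 < -Real.log z := neg_pos.2 (Real.log_neg hz.1 hz.2)
  have hz1 : 0 < 1 - z := by linarith [hz.2]
  have hF : (scalingLimit k (-Real.log z) : ℂ) ≠ 0 := by
    exact_mod_cast (scalingLimit_pos hk hs).ne'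
  rw [Pi.div_apply, Function.comp_apply, Real.div_rpow hz1.le hs.le, scalingOsc]
  have p1 : (((-Real.log z) ^ Real.logb k (alphaK k) : ℝ) : ℂ) ≠ 0 := by
    exact_mod_cast (Real.rpow_pos_of_pos hs _).ne'
  have p2 : (((1 - z) ^ Real.logb k (alphaK k) : ℝ) : ℂ) ≠ 0 := by
    exact_mod_cast (Real.rpow_pos_of_pos hz1 _).ne'
  simp only [Complex.ofReal_div, Complex.ofReal_mul]
  field_simp

lemma tendsto_const_mul_nhdsGT_zero {c : ℝ} (hc : 0 < c) :
    Filter.Tendsto (fun s : ℝ => c * s) (𝓝[>] 0) (𝓝[>] 0) := by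
  refine tendsto_nhdsWithin_iff.2 ⟨?_, ?_⟩
  · have : Filter.Tendsto (fun s : ℝ => c * s) (𝓝 0) (𝓝 (c * 0)) := by
      exact (continuous_const.mul continuous_id).tendsto 0
    rw [mul_zero] at this
    exact this.mono_left nhdsWithin_le_nhds
  · filter_upwards [self_mem_nhdsWithin] with s hs
    exact mul_pos hc hs

/-! ### Radial limits at roots of unity -/

/-- The quotient of `K` near the boundary point `ξ` by the scaling limit. -/
noncomputable def boundaryRatio (k : ℕ) (ξ : ℂ) (s : ℝ) : ℂ :=
  genK k (ξ * (Real.exp (-s) : ℝ)) / (scalingLimit k s : ℂ)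

lemma boundaryRatio_recursion {k : ℕ} (hk : 2 ≤ k) {ξ : ℂ} (hξ : ‖ξ‖ = 1) {s : ℝ} (hs : 0 < s) :
    boundaryRatio k ξ s =
      weightedGeom k (ξ * (Real.exp (-s) : ℝ)) * (alphaK k : ℂ)⁻¹ *
          boundaryRatio k (ξ ^ k) (k * s)
        + geom k (ξ * (Real.exp (-s) : ℝ)) * geom k ((ξ * (Real.exp (-s) : ℝ)) ^ k) *
          ((alphaK k : ℂ) ^ 2)⁻¹ * boundaryRatio k (ξ ^ k ^ 2) ((k : ℝ) ^ 2 * s)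
        - geom k (ξ * (Real.exp (-s) : ℝ)) * ((scalingLimit k s)⁻¹ : ℝ) := by
  have hnorm : ‖ξ * (Real.exp (-s) : ℝ)‖ < 1 := by
    rw [norm_mul, hξ, one_mul, Complex.norm_real, Real.norm_of_nonneg (Real.exp_pos _).le,
      Real.exp_lt_one_iff]
    linarith
  have e : ∀ n : ℕ, (ξ * (Real.exp (-s) : ℝ)) ^ n = ξ ^ n * (Real.exp (-(n * s)) : ℝ) := by
    intro n
    rw [mul_pow, ← Complex.ofReal_pow, ← Real.exp_nat_mul, mul_neg]
  have e2 := e (k ^ 2)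
  rw [Nat.cast_pow] at e2
  have hα := alphaK_ne_zero hk
  have hF : (scalingLimit k s : ℂ) ≠ 0 := by exact_mod_cast (scalingLimit_pos hk hs).ne'
  rw [boundaryRatio, boundaryRatio, boundaryRatio, genK_functional hk hnorm, e2, ← e k,
    scalingLimit_mul hk hs, scalingLimit_pow_mul hk 2 hs]
  push_cast
  field_simp

lemma continuous_geom (k : ℕ) : Continuous (geom k) := by
  unfold geom
  fun_prop

lemma continuous_weightedGeom (k : ℕ) : Continuous (weightedGeom k) := by
  unfold weightedGeom
  fun_prop

lemma tendsto_boundaryRatio_step {k : ℕ} (hk : 2 ≤ k) {ξ L₁ L₀ : ℂ} (hξ : ‖ξ‖ = 1)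
    (h₁ : Filter.Tendsto (boundaryRatio k (ξ ^ k)) (𝓝[>] 0) (𝓝 L₁))
    (h₀ : Filter.Tendsto (boundaryRatio k (ξ ^ k ^ 2)) (𝓝[>] 0) (𝓝 L₀)) :
    Filter.Tendsto (boundaryRatio k ξ) (𝓝[>] 0)
      (𝓝 (weightedGeom k ξ * (alphaK k : ℂ)⁻¹ * L₁
        + geom k ξ * geom k (ξ ^ k) * ((alphaK k : ℂ) ^ 2)⁻¹ * L₀)) := by
  have hkpos : (0 : ℝ) < k := by positivity
  have hz : Filter.Tendsto (fun s : ℝ => ξ * ((Real.exp (-s) : ℝ) : ℂ)) (𝓝[>] 0) (𝓝 ξ) := by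
    have : Continuous fun s : ℝ => ξ * ((Real.exp (-s) : ℝ) : ℂ) := by fun_prop
    have := (this.tendsto 0).mono_left (nhdsWithin_le_nhds (s := Set.Ioi 0))
    simpa using this
  have hw := ((continuous_weightedGeom k).tendsto ξ).comp hz
  have hg := ((continuous_geom k).tendsto ξ).comp hz
  have hg' := ((continuous_geom k).tendsto (ξ ^ k)).comp (hz.pow k)
  have r₁ := h₁.comp (tendsto_const_mul_nhdsGT_zero hkpos)
  have r₀ := h₀.comp (tendsto_const_mul_nhdsGT_zero (pow_pos hkpos 2))
  have hF := (Complex.continuous_ofReal.tendsto 0).comp (tendsto_inv_scalingLimit hk)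
  have h := (((hw.mul_const (alphaK k : ℂ)⁻¹).mul r₁).add
    (((hg.mul hg').mul_const ((alphaK k : ℂ) ^ 2)⁻¹).mul r₀)).sub (hg.mul hF)
  rw [Complex.ofReal_zero, mul_zero, sub_zero] at h
  refine h.congr' ?_
  filter_upwards [self_mem_nhdsWithin] with s hs
  exact (boundaryRatio_recursion hk hξ hs).symm

lemma norm_eq_one_of_pow_pow_eq_one {k : ℕ} (hk : 2 ≤ k) {m : ℕ} {ξ : ℂ} (hξ : ξ ^ k ^ m = 1) :
    ‖ξ‖ = 1 :=
  Complex.norm_eq_one_of_pow_eq_one hξ (by positivity)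

lemma tendsto_boundaryRatio_one {k : ℕ} (hk : 2 ≤ k) :
    Filter.Tendsto (boundaryRatio k 1) (𝓝[>] 0) (𝓝 1) := by
  have h := (Complex.continuous_ofReal.tendsto 1).comp (tendsto_realGenK_div_scalingLimit hk)
  rw [Complex.ofReal_one] at h
  refine h.congr fun s => ?_
  rw [boundaryRatio, one_mul, genK_ofReal, Function.comp_apply, Complex.ofReal_div]

/-- The limit of `boundaryRatio` at a root of unity of `k`-power order. -/
noncomputable def boundaryLimit (k : ℕ) (ξ : ℂ) : ℂ :=
  Filter.limUnder (𝓝[>] 0) (boundaryRatio k ξ)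

lemma boundaryLimit_one {k : ℕ} (hk : 2 ≤ k) : boundaryLimit k 1 = 1 :=
  (tendsto_boundaryRatio_one hk).limUnder_eq

lemma pow_pow_pred {k m : ℕ} {ξ : ℂ} (h : ξ ^ k ^ (m + 1) = 1) : (ξ ^ k) ^ k ^ m = 1 := by
  rwa [← pow_mul, ← pow_succ']

lemma pow_pow_of_pow {k m : ℕ} {ξ : ℂ} (h : ξ ^ k ^ m = 1) (n : ℕ) : (ξ ^ n) ^ k ^ m = 1 := by
  rw [← pow_mul, mul_comm, pow_mul, h, one_pow]

lemma tendsto_boundaryRatio {k : ℕ} (hk : 2 ≤ k) (m : ℕ) {ξ : ℂ} (hξ : ξ ^ k ^ m = 1) :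
    Filter.Tendsto (boundaryRatio k ξ) (𝓝[>] 0) (𝓝 (boundaryLimit k ξ)) := by
  -- Only existence of a limit remains, so that `limUnder` is not a default value.
  refine tendsto_nhds_limUnder ?_
  induction m generalizing ξ with
  | zero =>
    obtain rfl : ξ = 1 := by simpa using hξ
    exact ⟨1, tendsto_boundaryRatio_one hk⟩
  | succ m ih =>
    have h1 := pow_pow_pred hξ
    have h0 := pow_pow_of_pow h1 k
    rw [← pow_mul ξ, ← sq] at h0
    obtain ⟨L₁, hL₁⟩ := ih h1
    obtain ⟨L₀, hL₀⟩ := ih h0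
    exact ⟨_, tendsto_boundaryRatio_step hk (norm_eq_one_of_pow_pow_eq_one hk hξ) hL₁ hL₀⟩

lemma boundaryLimit_recursion {k : ℕ} (hk : 2 ≤ k) (m : ℕ) {ξ : ℂ} (hξ : ξ ^ k ^ m = 1) :
    boundaryLimit k ξ = weightedGeom k ξ * (alphaK k : ℂ)⁻¹ * boundaryLimit k (ξ ^ k)
      + geom k ξ * geom k (ξ ^ k) * ((alphaK k : ℂ) ^ 2)⁻¹ * boundaryLimit k (ξ ^ k ^ 2) :=
  (tendsto_boundaryRatio_step hk (norm_eq_one_of_pow_pow_eq_one hk hξ)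
    (tendsto_boundaryRatio hk m (pow_pow_of_pow hξ _))
    (tendsto_boundaryRatio hk m (pow_pow_of_pow hξ _))).limUnder_eq

/-! ### Nonvanishing of `Ω` -/

lemma geom_mul_sub_one (k : ℕ) (z : ℂ) : geom k z * (z - 1) = z ^ k - 1 :=
  geom_sum_mul z k

lemma weightedGeom_mul_sub_one (k : ℕ) (z : ℂ) :
    weightedGeom k z * (z - 1) = k * z ^ k - geom k z := by
  unfold weightedGeom geom
  induction k with
  | zero => simp
  | succ n ih =>
    rw [Finset.sum_range_succ, Finset.sum_range_succ, add_mul, ih]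
    push_cast
    ring

/-- The Möbius map `u ↦ 1/(u - 1)` sends the unit circle to a vertical line. -/
lemma re_inv_sub_one {u : ℂ} (hu : ‖u‖ = 1) (h1 : u ≠ 1) : ((u - 1)⁻¹).re = -1 / 2 := by
  have h2 : u.re * u.re + u.im * u.im = 1 := by
    rw [← Complex.normSq_apply, Complex.normSq_eq_norm_sq, hu, one_pow]
  have h3 : Complex.normSq (u - 1) = 2 - 2 * u.re := by
    rw [Complex.normSq_apply]
    simp
    linarith
  have h4 : Complex.normSq (u - 1) ≠ 0 := (Complex.normSq_pos.2 (sub_ne_zero.2 h1)).ne'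
  rw [Complex.inv_re, h3, div_eq_div_iff (by rwa [← h3]) (by norm_num)]
  simp
  ring

/-- The quotient is `k(1 + 1/(ξ^k - 1)) - 1/(ξ - 1)`, and both inverses have real part `-1/2`. -/
lemma re_weightedGeom_div_geom {k : ℕ} {ξ : ℂ} (hξ : ‖ξ‖ = 1) (h1 : ξ ≠ 1) (hS : geom k ξ ≠ 0) :
    (weightedGeom k ξ / geom k ξ).re = (k + 1) / 2 := by
  have hsub : ξ - 1 ≠ 0 := sub_ne_zero.2 h1
  have hη : ξ ^ k - 1 ≠ 0 := by
    rw [← geom_mul_sub_one]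
    exact mul_ne_zero hS hsub
  have h : weightedGeom k ξ / geom k ξ = k * (1 + (ξ ^ k - 1)⁻¹) - (ξ - 1)⁻¹ := by
    have e1 : geom k ξ = (ξ ^ k - 1) / (ξ - 1) := by
      rw [eq_div_iff hsub, geom_mul_sub_one]
    have e2 : weightedGeom k ξ = (k * ξ ^ k - geom k ξ) / (ξ - 1) := by
      rw [eq_div_iff hsub, weightedGeom_mul_sub_one]
    rw [e2, e1]
    field_simp
    ring
  have hn : ‖ξ ^ k‖ = 1 := by rw [norm_pow, hξ, one_pow]
  rw [h, Complex.sub_re, re_inv_sub_one hξ h1, ← Complex.ofReal_natCast, Complex.re_ofReal_mul,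
    Complex.add_re, re_inv_sub_one hn (sub_ne_zero.1 hη)]
  simp
  ring

/-- The half-plane condition is what carries the induction. If `y` is the quotient at `ξ^k`, then
`Ω(ξ) = α⁻¹ S(ξ) Ω(ξ^k) d` with `d = W/S + α⁻¹y`, where `Re d > 0`. So `Ω(ξ) ≠ 0`, and the new
quotient `α/d` is again in the half-plane. -/
theorem boundaryLimit_ne_zero_and_re_nonneg {k : ℕ} (hk : 2 ≤ k) (m : ℕ) {ξ : ℂ}
    (hξ : ξ ^ k ^ m = 1) : boundaryLimit k ξ ≠ 0 ∧
      0 ≤ (geom k ξ * boundaryLimit k (ξ ^ k) / boundaryLimit k ξ).re := by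
  have hα := alphaK_pos hk
  have hα' := alphaK_ne_zero hk
  have hk0 : (k : ℂ) ≠ 0 := by
    have : k ≠ 0 := by omega
    exact_mod_cast this
  have base : boundaryLimit k 1 ≠ 0 ∧
      0 ≤ (geom k 1 * boundaryLimit k (1 ^ k) / boundaryLimit k 1).re := by
    simp [boundaryLimit_one hk, geom_one]
  induction m generalizing ξ with
  | zero =>
    obtain rfl : ξ = 1 := by simpa using hξ
    exact base
  | succ m ih =>
    by_cases h1 : ξ = 1
    · subst h1
      exact base
    have hrec := boundaryLimit_recursion hk (m + 1) hξ
    -- Here `ξ^k = 1`, so `W(ξ)(ξ - 1) = k` and only the `W` term survives in the recursion; the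
    -- quotient is 0.
    by_cases hS : geom k ξ = 0
    · have hη : ξ ^ k = 1 := by
        have := geom_mul_sub_one k ξ
        rw [hS, zero_mul] at this
        exact sub_eq_zero.1 this.symm
      have hW : weightedGeom k ξ ≠ 0 := by
        intro hW
        have := weightedGeom_mul_sub_one k ξ
        rw [hW, hS, hη] at this
        simp at this
        exact hk0 this.symm
      rw [hS, hη, boundaryLimit_one hk] at hrec
      refine ⟨?_, by simp [hS]⟩
      rw [hrec]
      simp [hW, hα']
    · obtain ⟨i1, i2⟩ := ih (pow_pow_pred hξ)
      have hre := re_weightedGeom_div_geom (norm_eq_one_of_pow_pow_eq_one hk hξ) h1 hS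
      have hk2 : ξ ^ k ^ 2 = (ξ ^ k) ^ k := by rw [sq, pow_mul]
      rw [hk2] at hrec
      set y := geom k (ξ ^ k) * boundaryLimit k ((ξ ^ k) ^ k) / boundaryLimit k (ξ ^ k) with hy
      set d := weightedGeom k ξ / geom k ξ + ((alphaK k)⁻¹ : ℝ) * y with hd
      have hdre : 0 < d.re := by
        rw [hd, Complex.add_re, hre, Complex.re_ofReal_mul]
        positivity
      have hd0 : d ≠ 0 := fun h => by simp [h] at hdre
      have hΩ : boundaryLimit k ξ =
          (alphaK k : ℂ)⁻¹ * boundaryLimit k (ξ ^ k) * geom k ξ * d := by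
        rw [hrec, hd, hy]
        push_cast
        field_simp
      have hq : geom k ξ * boundaryLimit k (ξ ^ k) / boundaryLimit k ξ = (alphaK k : ℝ) * d⁻¹ := by
        rw [hΩ]
        field_simp
      refine ⟨?_, ?_⟩
      · rw [hΩ]
        simp [hα', i1, hS, hd0]
      · rw [hq, Complex.re_ofReal_mul, Complex.inv_re]
        have := Complex.normSq_nonneg d
        positivity

/-! ### Return to the variable `z` and conclusion -/

lemma genK_mul_isEquivalent {k : ℕ} (hk : 2 ≤ k) (m : ℕ) {ξ : ℂ} (hξ : ξ ^ k ^ m = 1) :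
    (fun z : ℝ => genK k (ξ * (z : ℂ))) ~[𝓝[<] 1] fun z : ℝ => boundaryLimit k ξ *
      ((scalingOsc k (-Real.log z) / (1 - z) ^ Real.logb (k : ℝ) (alphaK k) : ℝ) : ℂ) := by
  have h := isEquivalent_of_tendsto_div_scalingLimit hk
    (boundaryLimit_ne_zero_and_re_nonneg hk m hξ).1 (tendsto_boundaryRatio hk m hξ)
  refine h.congr_left ?_
  filter_upwards [Ioo_mem_nhdsLT zero_lt_one] with z hz
  rw [neg_neg, Real.exp_log hz.1]

lemma genK_pow_isEquivalent {k : ℕ} (hk : 2 ≤ k) (m : ℕ) :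
    (fun z : ℝ => genK k ((z : ℂ) ^ k ^ m)) ~[𝓝[<] 1] fun z : ℝ =>
      ((1 / alphaK k ^ m * (scalingOsc k (-Real.log z) /
        (1 - z) ^ Real.logb (k : ℝ) (alphaK k)) : ℝ) : ℂ) := by
  have hkm : (0 : ℝ) < (k : ℝ) ^ m := by positivity
  have hα : ((alphaK k : ℂ) ^ m)⁻¹ ≠ 0 := inv_ne_zero (pow_ne_zero _ (alphaK_ne_zero hk))
  have h := ((tendsto_boundaryRatio_one hk).comp
    (tendsto_const_mul_nhdsGT_zero hkm)).const_mul (((alphaK k : ℂ) ^ m)⁻¹)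
  rw [mul_one] at h
  have h2 := isEquivalent_of_tendsto_div_scalingLimit hk hα
    (g := fun s => genK k ((Real.exp (-((k : ℝ) ^ m * s)) : ℝ) : ℂ)) (h.congr' ?_)
  · refine (h2.congr_left ?_).congr_right ?_
    · filter_upwards [Ioo_mem_nhdsLT zero_lt_one] with z hz
      have : Real.exp (-((k : ℝ) ^ m * -Real.log z)) = z ^ k ^ m := by
        rw [mul_neg, neg_neg, ← Nat.cast_pow, Real.exp_nat_mul, Real.exp_log hz.1]
      rw [this, Complex.ofReal_pow]
    · refine Filter.Eventually.of_forall fun z => ?_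
      push_cast
      rw [one_div]
  · filter_upwards [self_mem_nhdsWithin] with s hs
    have hF : (scalingLimit k s : ℂ) ≠ 0 := by exact_mod_cast (scalingLimit_pos hk hs).ne'
    have := alphaK_ne_zero hk
    rw [Function.comp_apply, boundaryRatio, one_mul, scalingLimit_pow_mul hk m hs]
    push_cast
    field_simp

lemma analyticAt_rpow_const (β : ℝ) {x : ℝ} (hx : 0 < x) :
    AnalyticAt ℝ (fun t : ℝ => t ^ β) x := by
  refine ((analyticAt_id.log hx).mul (analyticAt_const (v := β))).rexp.congr ?_
  filter_upwards [lt_mem_nhds hx] with t ht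
  rw [Real.rpow_def_of_pos ht]
  rfl

lemma isOscillatoryTerm_scalingOsc {k : ℕ} (hk : 2 ≤ k) :
    IsOscillatoryTerm k fun z => scalingOsc k (-Real.log z) := by
  have hlog : ∀ z ∈ Set.Ioo (0 : ℝ) 1, 0 < -Real.log z := fun z hz =>
    neg_pos.2 (Real.log_neg hz.1 hz.2)
  refine ⟨fun z hz => ?_, ?_, fun z hz => ?_, genK_pow_isEquivalent hk⟩
  · have hl : AnalyticAt ℝ (fun z => -Real.log z) z := (analyticAt_id.log hz.1).neg
    have ho : AnalyticAt ℝ (scalingOsc k) (-Real.log z) := by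
      unfold scalingOsc
      exact (analyticAt_rpow_const _ (hlog z hz)).mul
        (analyticAt_scalingLimit hk (hlog z hz))
    exact AnalyticAt.comp (g := scalingOsc k) ho hl
  · obtain ⟨c₁, c₂, hc, hb⟩ := exists_scalingOsc_bounds hk
    refine ⟨c₁, c₂, hc, fun z hz => ?_⟩
    rw [abs_of_pos (scalingOsc_pos hk (hlog z hz))]
    exact hb _ (hlog z hz)
  · rw [Real.log_pow, ← mul_neg, scalingOsc_mul hk (hlog z hz)]

theorem mainTheorem7 (k : ℕ) (hk : 2 ≤ k) :
    ∃ (C : ℝ → ℝ) (Ω : ℂ → ℂ),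
      IsOscillatoryTerm k C ∧
      Ω 1 = 1 ∧
      (∀ (m : ℕ) (ξ : ℂ), ξ ^ (k ^ m) = 1 →
        (ξ - 1) * Ω ξ =
          ((k : ℂ) * ξ ^ k - ∑ a ∈ Finset.range k, ξ ^ a) * ((alphaK k : ℂ))⁻¹ * Ω (ξ ^ k)
            + (ξ ^ (k ^ 2) - 1) * ((alphaK k : ℂ) ^ 2)⁻¹ * Ω (ξ ^ (k ^ 2))) ∧
      (∀ (m : ℕ) (ξ : ℂ), ξ ^ (k ^ m) = 1 →
        (fun z : ℝ => genK k (ξ * (z : ℂ))) ~[𝓝[<] 1]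
          (fun z : ℝ =>
            Ω ξ * ((C z / (1 - z) ^ Real.logb (k : ℝ) (alphaK k) : ℝ) : ℂ))) := by
  refine ⟨fun z => scalingOsc k (-Real.log z), boundaryLimit k, isOscillatoryTerm_scalingOsc hk,
    boundaryLimit_one hk, fun m ξ hξ => ?_, fun m ξ hξ => genK_mul_isEquivalent hk m hξ⟩
  have h1 := weightedGeom_mul_sub_one k ξ
  have h2 := geom_mul_sub_one k ξ
  have h3 := geom_mul_sub_one k (ξ ^ k)
  rw [← pow_mul, ← sq] at h3
  change (ξ - 1) * boundaryLimit k ξ = (k * ξ ^ k - geom k ξ) * _ * _ + _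
  rw [boundaryLimit_recursion hk m hξ, ← h1, ← h3, ← h2]
  ring
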